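/- Setting. There are $m$ items and $n$ bidders. A general valuation is a function $v:2^{[m]}\to\mathbb R$ with $v(\emptyset)=0$ and $v(S)\le v(T)$ whenever $S\subseteq T$. For an integer $b\ge 1$, let $\mathcal V_{m,b}$ be the set of general valuations all of whose values have a $b$-bit floating-point description, that is, are of the form $a\cdot 2^{e}$ with integers $0\le a<2^b$ and $|e|<2^b$. A deterministic mechanism (in the blackboard model) is a finite protocol tree. At each inner vertex every bidder simultaneously sends one of finitely many messages (bidders with a single possible message are silent); all messages are seen by everyone, and the message profile determines the next vertex. Every leaf is labelled with an allocation $(S_1,\dots,S_n)$ of pairwise disjoint bundles and payments $p_1,\dots,p_n\in\mathbb R$. The mechanism is normalized if a bidder who receives the empty bundle always pays $0$, and has no negative transfers if all payments are always non-negative. Its communication complexity $cc(\mathcal M)$ is the maximum, over root-to-leaf paths, of the number of bits sent, where choosing one of $k$ messages costs $\lceil\log_2 k\rceil$ bits. A strategy of bidder $i$ dictates, given his valuation, his message at every vertex. It is dominant if, for all strategies of the other bidders, all valuation profiles and every alternative strategy of bidder $i$, following it gives bidder $i$ a profit (value of his bundle minus his payment) at least that of the alternative. A dominant strategy mechanism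 on $\mathcal V_{m,b}$ is a mechanism together with a dominant strategy of each bidder for valuations in $\mathcal V_{m,b}$. Its approximation ratio is better than $r$ if there is $\rho<r$ such that for every profile $(v_1,\dots,v_n)\in\mathcal V_{m,b}^n$ and every allocation $(A_1,\dots,A_n)$ we have $\sum_i v_i(A_i)\le\rho\sum_i v_i(S_i)$, where $(S_1,\dots,S_n)$ is the allocation reached when all bidders follow their dominant strategies. Theorem. Fix $\varepsilon>0$. There is an exponent $c>0$ such that for every $a>0$ there is $m_0$ such that the following holds for all $m\ge m_0$, all $n\ge a\,m^{2-\varepsilon}$ and all $b\ge 2m+1$ (in particular, for every bit length $b=\mathrm{poly}(m)$ with $b\ge 2m+1$). Let $\mathcal M$ be a deterministic, normalized, no-negative-transfers dominant strategy mechanism on $\mathcal V_{m,b}$ with $n$ bidders. If its approximation ratio is better than $m^{1-4\varepsilon}$, then $$cc(\mathcal M)\ \ge\ \left(\frac{2^{m^{\varepsilon^2/2}}}{n}\right)^{c}.$$ -/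

import Mathlib

/-- `x` has a floating-point description with mantissa and exponent of at most `b` bits each
(plus a sign bit for the exponent): `x = a * 2 ^ e` with `0 ≤ a < 2 ^ b` and `|e| < 2 ^ b`. -/
def IsDescribable (b : ℕ) (x : ℝ) : Prop :=
  ∃ (a : ℕ) (e : ℤ), a < 2 ^ b ∧ |e| < 2 ^ b ∧ x = (a : ℝ) * (2 : ℝ) ^ e

/-- A general valuation on `m` items: monotone, with value `0` for the empty bundle, such that
the value of every bundle has a description in the above format with parameter `b`. -/
structure GeneralValuation (m b : ℕ) where
  val : Finset (Fin m) → ℝ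
  monotone : ∀ S T : Finset (Fin m), S ⊆ T → val S ≤ val T
  empty : val ∅ = 0
  describable : ∀ S, IsDescribable b (val S)

/-- An allocation of (some of) the `m` items to `n` bidders: pairwise disjoint bundles. -/
structure Allocation (n m : ℕ) where
  bundle : Fin n → Finset (Fin m)
  disjoint : ∀ i j, i ≠ j → Disjoint (bundle i) (bundle j)

/-- The label of a leaf: an allocation and a payment of each bidder. -/
structure Outcome (n m : ℕ) where
  alloc : Allocation n m
  price : Fin n → ℝ

/-- A deterministic mechanism in the blackboard model, as a finite protocol tree. At an inner
vertex each bidder `i` simultaneously sends one of `k i + 1` messages (a bidder with `k i = 0`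
does not speak), and the message profile, seen by everyone, determines the next vertex. The
leaves are labelled with the outcome. -/
inductive Mechanism (n m : ℕ) : Type where
  | leaf (o : Outcome n m) : Mechanism n m
  | node (k : Fin n → ℕ) (next : (∀ i, Fin (k i + 1)) → Mechanism n m) : Mechanism n m

namespace Mechanism

variable {n m : ℕ}

/-- A plan of bidder `i`: a message for each vertex of the tree. -/
def Plan : Mechanism n m → Fin n → Type
  | leaf _, _ => Unit
  | node k next, i => Fin (k i + 1) × (∀ z, Plan (next z) i)

/-- The outcome at the leaf that is reached when every bidder follows his plan. -/
def run : (M : Mechanism n m) → (∀ i, M.Plan i) → Outcome n m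
  | leaf o, _ => o
  | node _ next, σ => run (next fun i => (σ i).1) fun i => (σ i).2 fun j => (σ j).1

/-- Communication complexity: the maximum over root-to-leaf paths of the number of bits sent,
where choosing one of `k` messages takes `⌈log₂ k⌉` bits. -/
def cc : Mechanism n m → ℕ
  | leaf _ => 0
  | node k next => (∑ i, Nat.clog 2 (k i + 1)) + Finset.univ.sup fun z => cc (next z)

/-- All leaves of the protocol tree satisfy `P`. -/
def EveryLeaf (P : Outcome n m → Prop) : Mechanism n m → Prop
  | leaf o => P o
  | node _ next => ∀ z, EveryLeaf P (next z)

/-- The price of the empty bundle is always zero. -/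
def Normalized (M : Mechanism n m) : Prop :=
  M.EveryLeaf fun o => ∀ i, o.alloc.bundle i = ∅ → o.price i = 0

/-- Payments are always non-negative. -/
def NoNegativeTransfers (M : Mechanism n m) : Prop :=
  M.EveryLeaf fun o => ∀ i, 0 ≤ o.price i

/-- A strategy of bidder `i`: it dictates, given his valuation, his message at each vertex. -/
def Strategy (M : Mechanism n m) (b : ℕ) (i : Fin n) : Type :=
  GeneralValuation m b → M.Plan i

end Mechanism

/-- The profit of bidder `i` with valuation `v`: the value of his bundle minus his payment. -/
def profit {n m b : ℕ} (i : Fin n) (v : GeneralValuation m b) (o : Outcome n m) : ℝ :=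
  v.val (o.alloc.bundle i) - o.price i

/-- Social welfare. -/
def welfare {n m b : ℕ} (v : Fin n → GeneralValuation m b) (A : Allocation n m) : ℝ :=
  ∑ i, (v i).val (A.bundle i)

namespace Mechanism

variable {n m : ℕ}

/-- The strategy `s` is dominant for bidder `i`: for all strategies of the other bidders, all
valuation profiles and every alternative strategy `S' i` of bidder `i`, his profit when he
follows `s` is at least his profit when he follows `S' i`. -/
def IsDominant (M : Mechanism n m) (b : ℕ) (i : Fin n) (s : M.Strategy b i) : Prop :=
  ∀ (S' : ∀ j, M.Strategy b j) (v : Fin n → GeneralValuation m b),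
    profit i (v i) (M.run fun j => S' j (v j)) ≤
      profit i (v i) (M.run (Function.update (fun j => S' j (v j)) i (s (v i))))

/-- When the bidders follow the strategies `S`, the mechanism always outputs an allocation
whose welfare is within a factor `ρ` of the optimal welfare. -/
def Approximates (M : Mechanism n m) (b : ℕ) (S : ∀ i, M.Strategy b i) (ρ : ℝ) : Prop :=
  ∀ (v : Fin n → GeneralValuation m b) (A : Allocation n m),
    welfare v A ≤ ρ * welfare v (M.run fun i => S i (v i)).alloc

end Mechanism

/-! A dominant strategy must be optimal against opponents who behave in unrelated ways in different
subtrees. Hence, with the other messages at a vertex fixed, the worst outcome after a bidder's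
prescribed message is at least as good for him as the best outcome after any other message
(`DominantPlan.le_of_message_ne`).

Values are placed on scales `K l` so far apart that a bidder alone on the top scale must win. Every
vertex at which somebody can speak costs a bit, so with about `12 * cc` scales there is a vertex
where nothing has been revealed about a range of scales and somebody is about to reveal something
(`exists_splitting_node`). There every bidder must separate each low valuation from the highest one
(`message_const_of_unsplit`). It follows that a low bidder who wins at a price other than his value,
and who had some report that yields nothing, has a plan consistent with his message that wins a
wanted bundle below the vertex whatever the others do (`exists_guaranteed_win`). These plans can be
played simultaneously, so disjointness of bundles bounds the number of such bidders, and who they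
are depends only on the messages at this one vertex.

The hard instance has a common bundle `U` and a special bundle `Q u` for each of `g` groups of
bidders, all of size `s`. A bidder of group `u` wants each `s`-subset of `U ∪ Q u` with probability
`1 / q`, independently. In expectation, somebody wants `Q u` in at least half of the groups, so good
welfare needs many winners. At most `s` winners get items of `U`. Every other winner wants his own
`Q u` and either receives something under all reports (at most `m` bidders, independently of their
own types), or pays exactly his value (rare, as values are random), or is guaranteed a win. In the
last case his message must make `Q u` unusually likely to be wanted, except with probability `3 /
q`. By an entropy bound (`sum_card_biased_le`) a short message does so for few of the `(2 *
s).choose s` candidate sets, and a random permutation of the items makes `Q u` a typical candidate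
(`exists_perm_sum_biased_le`). `half_groups_le` adds up the contributions. For `s ≈ m ^ ε` and `q ≈
2 * g ≈ m ^ (1 - ε)` they are too small unless the communication is exponential. -/

namespace Mechanism

/-! ### Dominance at a single vertex of the protocol tree -/

variable {n m b : ℕ}

/-- The plan `σ` is optimal for bidder `i` with valuation `v` against all plans of the others. -/
def DominantPlan (M : Mechanism n m) (i : Fin n) (v : GeneralValuation m b) (σ : M.Plan i) : Prop :=
  ∀ τ : ∀ j, M.Plan j,
    profit i v (M.run τ) ≤ profit i v (M.run (Function.update τ i σ))

theorem IsDominant.dominantPlan {M : Mechanism n m} {i : Fin n} {s : M.Strategy b i}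
    (h : M.IsDominant b i s) (v : GeneralValuation m b) : M.DominantPlan i v (s v) :=
  fun τ => h (fun j _ => τ j) fun _ => v

theorem nonempty_plan (M : Mechanism n m) (i : Fin n) : Nonempty (M.Plan i) := by
  induction M with
  | leaf o => exact ⟨()⟩
  | node k next ih => exact ⟨((0 : Fin (k i + 1)), fun z => (ih z).some)⟩

noncomputable instance (M : Mechanism n m) (i : Fin n) : Inhabited (M.Plan i) :=
  ⟨(M.nonempty_plan i).some⟩

theorem EveryLeaf.run {P : Outcome n m → Prop} {M : Mechanism n m} (h : M.EveryLeaf P)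
    (τ : ∀ j, M.Plan j) : P (M.run τ) := by
  induction M with
  | leaf o => exact h
  | node k next ih => exact ih _ (h _) _

/-- The first messages enter through an equation, since the type of the remaining plans depends on
them and they cannot be rewritten in place. -/
theorem run_node {k : Fin n → ℕ} {next : (∀ i, Fin (k i + 1)) → Mechanism n m}
    (σ : ∀ j, (node k next).Plan j) (z : ∀ i, Fin (k i + 1)) (hz : ∀ j, (σ j).1 = z j) :
    (node k next).run σ = (next z).run fun j => (σ j).2 z := by
  obtain rfl : (fun j => (σ j).1) = z := funext hz
  rfl

section node

variable {k : Fin n → ℕ} {next : (∀ i, Fin (k i + 1)) → Mechanism n m}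

/-- The plan that sends `a` first and then follows `p` in the subtree at `z`, and `p'` in the
subtree at `z'`. -/
noncomputable def joinPlan {j : Fin n} (a : Fin (k j + 1)) (z z' : ∀ i, Fin (k i + 1))
    (p : (next z).Plan j) (p' : (next z').Plan j) : (node k next).Plan j :=
  (a, Function.update (Function.update (fun _ => default) z' p') z p)

/-- The opponents can follow `τ` below `z` and the unrelated `τ'` below `z'`, because a plan is free
to differ between subtrees. This is where dominance is stronger than ex post truthfulness. -/
theorem DominantPlan.le_of_message_ne {i : Fin n} {v : GeneralValuation m b}
    {σ : (node k next).Plan i} (h : (node k next).DominantPlan i v σ)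
    {z z' : ∀ i, Fin (k i + 1)} (hz : σ.1 = z i) (hne : z' i ≠ z i)
    (hoff : ∀ j, j ≠ i → z' j = z j) (τ : ∀ j, (next z).Plan j) (hτ : τ i = σ.2 z)
    (τ' : ∀ j, (next z').Plan j) :
    profit i v ((next z').run τ') ≤ profit i v ((next z).run τ) := by
  have hzz : z' ≠ z := fun e => hne (congrFun e i)
  have key := h fun j => joinPlan (z' j) z z' (τ j) (τ' j)
  rw [run_node _ z' fun j => rfl, run_node _ z] at key
  · convert key using 3 with j
    · funext j
      simp [joinPlan, hzz]
    · funext j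
      by_cases hj : j = i
      · subst hj
        simp [hτ]
      · rw [Function.update_of_ne hj]
        simp [joinPlan]
  · intro j
    by_cases hj : j = i
    · subst hj
      simpa using hz
    · rw [Function.update_of_ne hj]
      exact hoff j hj

theorem DominantPlan.subtree {i : Fin n} {v : GeneralValuation m b}
    {σ : (node k next).Plan i} (h : (node k next).DominantPlan i v σ)
    {z : ∀ i, Fin (k i + 1)} (hz : σ.1 = z i) : (next z).DominantPlan i v (σ.2 z) := by
  intro τ
  have key := h fun j => joinPlan (z j) z z (τ j) (τ j)
  rw [run_node _ z fun j => rfl, run_node _ z] at key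
  · convert key using 3 with j
    · funext j
      simp [joinPlan]
    · funext j
      by_cases hj : j = i
      · subst hj
        simp
      · rw [Function.update_of_ne hj, Function.update_of_ne hj]
        simp [joinPlan]
  · intro j
    by_cases hj : j = i
    · subst hj
      simpa using hz
    · rw [Function.update_of_ne hj]
      rfl

end node

theorem cc_next_le {k : Fin n → ℕ} {next : (∀ i, Fin (k i + 1)) → Mechanism n m}
    (z : ∀ i, Fin (k i + 1)) :
    (∑ i, Nat.clog 2 (k i + 1)) + (next z).cc ≤ (node k next).cc := by
  rw [cc]
  exact Nat.add_le_add_left (Finset.le_sup (f := fun z => (next z).cc) (Finset.mem_univ z)) _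

theorem clog_pos_of_ne {a : ℕ} {x y : Fin (a + 1)} (h : x ≠ y) : 0 < Nat.clog 2 (a + 1) := by
  apply Nat.clog_pos (by norm_num)
  rcases a with _ | a
  · exact absurd (Subsingleton.elim (α := Fin 1) x y) h
  · omega

theorem run_eq_of_cc_eq_zero {M : Mechanism n m} (h : M.cc = 0) (τ τ' : ∀ j, M.Plan j) :
    M.run τ = M.run τ' := by
  induction M with
  | leaf o => rfl
  | node k next ih =>
    have key : ∀ j, (τ j).1 = (τ' j).1 := by
      intro j
      by_contra hne
      have h1 := clog_pos_of_ne hne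
      have h2 := cc_next_le (next := next) fun j => (τ j).1
      have h3 := Finset.single_le_sum (f := fun i => Nat.clog 2 (k i + 1))
        (fun _ _ => Nat.zero_le _) (Finset.mem_univ j)
      omega
    rw [run_node τ (fun j => (τ j).1) fun _ => rfl, run_node τ' (fun j => (τ j).1)
      fun j => (key j).symm]
    refine ih _ ?_ _ _
    have h2 := cc_next_le (next := next) fun j => (τ j).1
    omega

end Mechanism

/-! ### Valuations with one positive value, and widely separated scales -/

/-- An upward closed family of nonempty bundles that contains the grand bundle. -/
structure UpFamily (m : ℕ) where
  carrier : Set (Finset (Fin m))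
  upper : ∀ S T, S ⊆ T → S ∈ carrier → T ∈ carrier
  empty_notMem : ∅ ∉ carrier
  univ_mem : Finset.univ ∈ carrier

namespace UpFamily

/-- The family that consists of the grand bundle. -/
def grand (m : ℕ) (hm : 0 < m) : UpFamily m where
  carrier := {Finset.univ}
  upper S T h hS := by
    obtain rfl : S = Finset.univ := hS
    exact Finset.univ_subset_iff.1 h
  empty_notMem h := by
    have : (⟨0, hm⟩ : Fin m) ∈ (∅ : Finset (Fin m)) := by
      rw [show (∅ : Finset (Fin m)) = Finset.univ from h]
      exact Finset.mem_univ _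
    simp at this
  univ_mem := rfl

/-- The family of all nonempty bundles. -/
def nonempty (m : ℕ) (hm : 0 < m) : UpFamily m where
  carrier := {S | S.Nonempty}
  upper _ _ h hS := hS.mono h
  empty_notMem := by simp
  univ_mem := ⟨⟨0, hm⟩, Finset.mem_univ _⟩

end UpFamily

theorem IsDescribable.nonneg {b : ℕ} {c : ℝ} (h : IsDescribable b c) : 0 ≤ c := by
  obtain ⟨a, e, -, -, rfl⟩ := h
  positivity

theorem isDescribable_zero (b : ℕ) : IsDescribable b 0 :=
  ⟨0, 0, by positivity, by simp, by simp⟩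

open Classical in
/-- The valuation with value `c` on the bundles in `F` and `0` on all others. -/
noncomputable def UpFamily.valuation {m b : ℕ} (F : UpFamily m) (c : ℝ)
    (hc : IsDescribable b c) : GeneralValuation m b where
  val S := if S ∈ F.carrier then c else 0
  monotone S T h := by
    have := hc.nonneg
    by_cases hS : S ∈ F.carrier
    · rw [if_pos hS, if_pos (F.upper S T h hS)]
    · rw [if_neg hS]
      split_ifs <;> simp [this]
  empty := if_neg F.empty_notMem
  describable S := by
    split_ifs
    · exact hc
    · exact isDescribable_zero b

namespace UpFamily

variable {m b : ℕ} (F : UpFamily m) {c : ℝ} (hc : IsDescribable b c)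

theorem val_of_mem {S : Finset (Fin m)} (h : S ∈ F.carrier) : (F.valuation c hc).val S = c :=
  if_pos h

theorem val_of_notMem {S : Finset (Fin m)} (h : S ∉ F.carrier) : (F.valuation c hc).val S = 0 :=
  if_neg h

@[simp] theorem val_univ : (F.valuation c hc).val Finset.univ = c := F.val_of_mem hc F.univ_mem

theorem mem_of_val_pos {S : Finset (Fin m)} (h : 0 < (F.valuation c hc).val S) :
    S ∈ F.carrier := by
  by_contra hS
  rw [F.val_of_notMem hc hS] at h
  exact h.false

end UpFamily

namespace GeneralValuation

variable {m b : ℕ} (v : GeneralValuation m b)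

theorem val_nonneg (S : Finset (Fin m)) : 0 ≤ v.val S := (v.describable S).nonneg

theorem val_le_univ (S : Finset (Fin m)) : v.val S ≤ v.val Finset.univ :=
  v.monotone _ _ (Finset.subset_univ S)

end GeneralValuation

/-- The allocation that gives the grand bundle to bidder `j`. -/
def Allocation.all {n : ℕ} (m : ℕ) (j : Fin n) : Allocation n m where
  bundle i := if i = j then Finset.univ else ∅
  disjoint a c hac := by
    by_cases h : a = j
    · subst h
      simp [hac.symm]
    · simp [h]

theorem welfare_all {n m b : ℕ} (v : Fin n → GeneralValuation m b) (j : Fin n) :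
    welfare v (Allocation.all m j) = (v j).val Finset.univ := by
  unfold welfare
  rw [Finset.sum_eq_single j]
  · simp [Allocation.all]
  · intro i _ hi
    simp [Allocation.all, hi, (v i).empty]
  · simp

/-- An increasing sequence of describable scales with gaps that are large in comparison with the
approximation ratio `ρ` and the number of bidders. -/
structure IsScale (n b L : ℕ) (ρ : ℝ) (K : ℕ → ℝ) : Prop where
  pos : ∀ l, 0 < K l
  strictMono : StrictMono K
  gap : ∀ l, ρ * (n * K l) < K (l + 1)
  describable : ∀ l, l ≤ L → IsDescribable b (K l)

/-- The valuations in which the grand bundle has a value between `K Y` and `K L`. -/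
def between (m b : ℕ) (K : ℕ → ℝ) (Y L : ℕ) : Set (GeneralValuation m b) :=
  {v | K Y ≤ v.val Finset.univ ∧ v.val Finset.univ ≤ K L}

theorem UpFamily.valuation_mem_between {n m b L : ℕ} {ρ : ℝ} {K : ℕ → ℝ} (hK : IsScale n b L ρ K)
    (F : UpFamily m) {l Y : ℕ} (hl : l ≤ L) (hY : Y ≤ l) :
    F.valuation (K l) (hK.describable l hl) ∈ between m b K Y L := by
  refine ⟨?_, ?_⟩ <;> rw [F.val_univ]
  · exact hK.strictMono.monotone hY
  · exact hK.strictMono.monotone hl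

/-! ### Mechanisms that are correct on a class of valuations -/

namespace Mechanism

/-- The strategies `S` are dominant and achieve the approximation ratio `ρ` for valuations in `C`;
the mechanism is normalized and has no negative transfers. -/
structure Solves {n m b : ℕ} (M : Mechanism n m) (S : ∀ i, GeneralValuation m b → M.Plan i)
    (C : Set (GeneralValuation m b)) (ρ : ℝ) : Prop where
  dominant : ∀ i, ∀ v ∈ C, M.DominantPlan i v (S i v)
  approx : ∀ v : Fin n → GeneralValuation m b, (∀ i, v i ∈ C) → ∀ A,
    welfare v A ≤ ρ * welfare v (M.run fun i => S i (v i)).alloc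
  normalized : M.Normalized
  noNegativeTransfers : M.NoNegativeTransfers

namespace Solves

variable {n m b : ℕ} {ρ : ℝ} {C : Set (GeneralValuation m b)}

section general

variable {M : Mechanism n m} {S : ∀ i, GeneralValuation m b → M.Plan i} (h : M.Solves S C ρ)
  {v : Fin n → GeneralValuation m b} (hv : ∀ i, v i ∈ C)
include h

theorem profit_eq_zero {τ : ∀ j, M.Plan j} {i : Fin n} (hi : (M.run τ).alloc.bundle i = ∅)
    (w : GeneralValuation m b) : profit i w (M.run τ) = 0 := by
  rw [profit, hi, w.empty, h.normalized.run τ i hi, sub_zero]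

theorem profit_update_le {i : Fin n} (hi : v i ∈ C) (w : GeneralValuation m b) :
    profit i (v i) (M.run fun j => S j (Function.update v i w j)) ≤
      profit i (v i) (M.run fun j => S j (v j)) := by
  convert h.dominant i (v i) hi (fun j => S j (Function.update v i w j)) using 3
  funext j
  by_cases hj : j = i
  · subst hj
    simp
  · simp [hj]

-- Otherwise the welfare is at most `n * K l`, while giving everything to `j` yields at least `K (l
-- + 1) > ρ * (n * K l)`.
include hv in
theorem val_pos_of_gap {K : ℕ → ℝ} {L l : ℕ} (hK : IsScale n b L ρ K) (hρ : 0 ≤ ρ) {j : Fin n}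
    (hj : K (l + 1) ≤ (v j).val Finset.univ)
    (hl : ∀ i, i ≠ j → (v i).val Finset.univ ≤ K l) :
    0 < (v j).val ((M.run fun i => S i (v i)).alloc.bundle j) := by
  set o := M.run fun i => S i (v i) with ho
  refine lt_of_le_of_ne ((v j).val_nonneg _) fun h0 => ?_
  have h1 := h.approx v hv (Allocation.all m j)
  rw [welfare_all, ← ho] at h1
  have h2 : welfare v o.alloc ≤ n * K l := by
    unfold welfare
    calc ∑ i, (v i).val (o.alloc.bundle i) ≤ ∑ _i : Fin n, K l := by
          refine Finset.sum_le_sum fun i _ => ?_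
          by_cases hij : i = j
          · subst hij
            rw [← h0]
            exact (hK.pos l).le
          · exact ((v i).val_le_univ _).trans (hl i hij)
      _ = n * K l := by simp
  have h3 := mul_le_mul_of_nonneg_left h2 hρ
  have h4 := hK.gap l
  linarith

-- The only bundle of positive value to `j` is the grand bundle. Such a bidder on a top scale is the
-- device that forces all others to leave with nothing.
include hv in
theorem bundle_eq_univ_of_gap {K : ℕ → ℝ} {L l : ℕ} (hK : IsScale n b L ρ K) (hρ : 0 ≤ ρ)
    {j : Fin n} {hm : 0 < m} {c : ℝ} {hc : IsDescribable b c}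
    (hvj : v j = (UpFamily.grand m hm).valuation c hc) (hj : K (l + 1) ≤ c)
    (hl : ∀ i, i ≠ j → (v i).val Finset.univ ≤ K l) :
    (M.run fun i => S i (v i)).alloc.bundle j = Finset.univ := by
  have := h.val_pos_of_gap hv hK hρ (j := j) (l := l) (by rw [hvj]; simpa using hj) hl
  rw [hvj] at this
  exact UpFamily.mem_of_val_pos _ _ this

include hv in
theorem bundle_eq_empty_of_gap {K : ℕ → ℝ} {L l : ℕ} (hK : IsScale n b L ρ K) (hρ : 0 ≤ ρ)
    {j : Fin n} {hm : 0 < m} {c : ℝ} {hc : IsDescribable b c}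
    (hvj : v j = (UpFamily.grand m hm).valuation c hc) (hj : K (l + 1) ≤ c)
    (hl : ∀ i, i ≠ j → (v i).val Finset.univ ≤ K l) {i : Fin n} (hij : i ≠ j) :
    (M.run fun i => S i (v i)).alloc.bundle i = ∅ := by
  have h1 := h.bundle_eq_univ_of_gap hv hK hρ hvj hj hl
  have h2 := (M.run fun i => S i (v i)).alloc.disjoint i j hij
  rw [h1] at h2
  exact disjoint_top.1 h2

end general

section node

variable {k : Fin n → ℕ} {next : (∀ i, Fin (k i + 1)) → Mechanism n m}
  {S : ∀ i, GeneralValuation m b → (node k next).Plan i} (h : (node k next).Solves S C ρ)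
include h

theorem subtree {C' : Set (GeneralValuation m b)} (hC : C' ⊆ C) (z : ∀ i, Fin (k i + 1))
    (hz : ∀ i, ∀ v ∈ C', (S i v).1 = z i) :
    (next z).Solves (fun i v => (S i v).2 z) C' ρ where
  dominant i v hv := (h.dominant i v (hC hv)).subtree (hz i v hv)
  approx v hv A := by
    have := h.approx v (fun i => hC (hv i)) A
    rwa [run_node _ z fun j => hz j _ (hv j)] at this
  normalized := h.normalized z
  noNegativeTransfers := h.noNegativeTransfers z

/-- The other bidders need only agree in their messages at this vertex; their valuations may differ
arbitrarily between the two profiles. All later contradictions exploit this freedom. -/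
theorem profit_le_of_message_ne {v v' : Fin n → GeneralValuation m b} {i : Fin n} (hv : v i ∈ C)
    (hne : (S i (v' i)).1 ≠ (S i (v i)).1) (hoff : ∀ j, j ≠ i → (S j (v' j)).1 = (S j (v j)).1) :
    profit i (v i) ((node k next).run fun j => S j (v' j)) ≤
      profit i (v i) ((node k next).run fun j => S j (v j)) := by
  rw [run_node _ (fun j => (S j (v' j)).1) fun j => rfl,
    run_node _ (fun j => (S j (v j)).1) fun j => rfl]
  exact (h.dominant i (v i) hv).le_of_message_ne rfl hne hoff _ rfl _

end node

end Solves

/-! ### Descent to a vertex where information is first revealed -/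

/-- Below some vertex a scale range remains on which no bidder has revealed anything, and at that
vertex some bidder tells apart two valuations in a slightly higher range. -/
theorem exists_splitting_node {n m b L : ℕ} {ρ : ℝ} {K : ℕ → ℝ} (hn : 2 ≤ n) (hm : 0 < m)
    (hρ : 0 ≤ ρ) (hK : IsScale n b L ρ K) (d : ℕ) (M : Mechanism n m) :
    ∀ (S : ∀ i, GeneralValuation m b → M.Plan i) (Y : ℕ), Y + d * (M.cc + 1) + 1 ≤ L →
      M.Solves S (between m b K Y L) ρ →
      ∃ (k : Fin n → ℕ) (next : (∀ i, Fin (k i + 1)) → Mechanism n m)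
        (S' : ∀ i, GeneralValuation m b → (node k next).Plan i) (Y' : ℕ),
        (node k next).cc ≤ M.cc ∧ Y' + d + 1 ≤ L ∧
        (node k next).Solves S' (between m b K Y' L) ρ ∧
        ∃ i, ∃ w ∈ between m b K (Y' + d) L, ∃ w' ∈ between m b K (Y' + d) L,
          (S' i w).1 ≠ (S' i w').1 := by
  induction M with
  | leaf o =>
    intro S Y hY h
    exfalso
    have hL : Y + 1 ≤ L := by
      have := Nat.zero_le (d * ((leaf o : Mechanism n m).cc + 1))
      omega
    -- A leaf has one allocation for all profiles, yet each bidder in turn can be made the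
    -- dominating one.
    have key : ∀ j : Fin n, o.alloc.bundle j = Finset.univ := by
      intro j
      refine h.bundle_eq_univ_of_gap (v := fun i => if i = j
        then (UpFamily.grand m hm).valuation (K (Y + 1)) (hK.describable _ hL)
        else (UpFamily.grand m hm).valuation (K Y) (hK.describable _ (by omega)))
        (l := Y) ?_ hK hρ (if_pos rfl) le_rfl ?_
      · intro i
        split_ifs
        · exact UpFamily.valuation_mem_between hK _ hL (by omega)
        · exact UpFamily.valuation_mem_between hK _ (by omega) le_rfl
      · intro i hi
        simp [hi]
    have h1 := o.alloc.disjoint ⟨0, by omega⟩ ⟨1, by omega⟩ (by simp)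
    rw [key, key, Finset.disjoint_self_iff_empty] at h1
    have : (⟨0, hm⟩ : Fin m) ∈ (Finset.univ : Finset (Fin m)) := Finset.mem_univ _
    rw [h1] at this
    simp at this
  | node k next ih =>
    intro S Y hY h
    have hYd : Y + d + 1 ≤ L := by
      have : d * 1 ≤ d * ((node k next).cc + 1) := Nat.mul_le_mul_left _ (by omega)
      omega
    by_cases hsplit : ∃ i, ∃ w ∈ between m b K (Y + d) L, ∃ w' ∈ between m b K (Y + d) L,
        (S i w).1 ≠ (S i w').1
    · exact ⟨k, next, S, Y, le_rfl, hYd, h, hsplit⟩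
    push Not at hsplit
    have hsub : between m b K (Y + d) L ⊆ between m b K Y L := fun v hv =>
      ⟨(hK.strictMono.monotone (by omega)).trans hv.1, hv.2⟩
    -- This valuation lies in every range that occurs, so its messages mark the common path.
    set t := (UpFamily.grand m hm).valuation (K L) (hK.describable L le_rfl)
    have ht : t ∈ between m b K (Y + d) L :=
      UpFamily.valuation_mem_between hK _ le_rfl (by omega)
    let z : ∀ i, Fin (k i + 1) := fun i => (S i t).1
    have hcc := cc_next_le (next := next) z
    -- If somebody has a choice, the vertex costs a bit, which pays for giving up `d` scales. A
    -- silent vertex costs nothing, so there the range must be kept.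
    by_cases hk : ∃ i, k i ≠ 0
    · obtain ⟨i, hi⟩ := hk
      have h1 : 0 < Nat.clog 2 (k i + 1) := Nat.clog_pos (by norm_num) (by omega)
      have h3 := Finset.single_le_sum (f := fun i => Nat.clog 2 (k i + 1))
        (fun _ _ => Nat.zero_le _) (Finset.mem_univ i)
      have h4 : (next z).cc + 1 ≤ (node k next).cc := by omega
      obtain ⟨k', next', S', Y', hc, hrest⟩ := ih z _ (Y + d) (by nlinarith)
        (h.subtree hsub z fun i v hv => hsplit i v hv t ht)
      exact ⟨k', next', S', Y', by omega, hrest⟩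
    · push Not at hk
      have h4 : (next z).cc ≤ (node k next).cc := by omega
      obtain ⟨k', next', S', Y', hc, hrest⟩ := ih z _ Y (by nlinarith)
        (h.subtree subset_rfl z fun i v hv => by
          have := (S i v).1.2
          have := (z i).2
          have := hk i
          ext
          omega)
      exact ⟨k', next', S', Y', by omega, hrest⟩

end Mechanism

/-! ### Incentives at the splitting vertex -/

namespace Mechanism.Solves

variable {n m b L Y : ℕ} {ρ : ℝ} {K : ℕ → ℝ}
  {k : Fin n → ℕ} {next : (∀ i, Fin (k i + 1)) → Mechanism n m}
  {S : ∀ i, GeneralValuation m b → (node k next).Plan i}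

/-- Against `t`, bidder `j` with valuation `w` wins at a price of at most his value, which is below
`K l`. If his message differed from that of the valuation `B` of value `K l`, then `B` would envy
this outcome: bidder `i`, sending the same message as with `t`, may turn out to have the higher
value `K (l + 1)` and take everything. -/
theorem message_eq_of_unsplit (h : (node k next).Solves S (between m b K Y L) ρ)
    (hK : IsScale n b L ρ K) (hρ : 0 ≤ ρ) (hm : 0 < m) (hn : 3 ≤ n) {i : Fin n}
    {t : GeneralValuation m b} {a l : ℕ}
    (ht : t ∈ between m b K Y L) (hta : t.val Finset.univ ≤ K a) (hY : Y ≤ a) (hal : a + 1 ≤ l)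
    (hl : l + 1 ≤ L)
    (hmsg : (S i t).1 =
      (S i ((UpFamily.grand m hm).valuation (K (l + 1)) (hK.describable _ hl))).1)
    {j : Fin n} (hji : j ≠ i) {w : GeneralValuation m b} (hw : K (a + 2) ≤ w.val Finset.univ)
    (hwl : w.val Finset.univ < K l) :
    (S j w).1 =
      (S j ((UpFamily.nonempty m hm).valuation (K l) (hK.describable l (by omega)))).1 := by
  have mono := hK.strictMono.monotone
  by_contra hne
  -- The third bidder `c`, one scale above `t`, takes everything when `j` reports the low `Z`. So
  -- `j` has a report of profit zero, which makes truthful play individually rational.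
  obtain ⟨c, hci, hcj⟩ : ∃ c : Fin n, c ≠ i ∧ c ≠ j := by
    by_contra! hc
    have : (Finset.univ : Finset (Fin n)) ⊆ {i, j} := fun x _ => by
      by_cases hx : x = i
      · simp [hx]
      · simp [hc x hx]
    have := (Finset.card_le_card this).trans Finset.card_le_two
    simp at this
    omega
  set A : GeneralValuation m b :=
    (UpFamily.grand m hm).valuation (K (l + 1)) (hK.describable _ hl) with hA
  set B : GeneralValuation m b :=
    (UpFamily.nonempty m hm).valuation (K l) (hK.describable l (by omega)) with hB
  set E : GeneralValuation m b :=
    (UpFamily.grand m hm).valuation (K (a + 1)) (hK.describable _ (by omega)) with hE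
  set Z : GeneralValuation m b :=
    (UpFamily.grand m hm).valuation (K Y) (hK.describable _ (by omega)) with hZ
  have hAC : A ∈ between m b K Y L := UpFamily.valuation_mem_between hK _ hl (by omega)
  have hBC : B ∈ between m b K Y L := UpFamily.valuation_mem_between hK _ (by omega) (by omega)
  have hEC : E ∈ between m b K Y L := UpFamily.valuation_mem_between hK _ (by omega) (by omega)
  have hZC : Z ∈ between m b K Y L := UpFamily.valuation_mem_between hK _ (by omega) le_rfl
  have hwC : w ∈ between m b K Y L :=
    ⟨(mono (by omega)).trans hw, hwl.le.trans (mono (by omega))⟩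
  have hAu : A.val Finset.univ = K (l + 1) := UpFamily.val_univ _ _
  have hBu : B.val Finset.univ = K l := UpFamily.val_univ _ _
  have hEu : E.val Finset.univ = K (a + 1) := UpFamily.val_univ _ _
  have hZu : Z.val Finset.univ = K Y := UpFamily.val_univ _ _
  let prof : GeneralValuation m b → GeneralValuation m b → Fin n → GeneralValuation m b :=
    fun x y d => if d = j then y else if d = i then x else if d = c then E else Z
  have hprof : ∀ x ∈ between m b K Y L, ∀ y ∈ between m b K Y L, ∀ d,
      prof x y d ∈ between m b K Y L := by
    intro x hx y hy d
    simp only [prof]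
    split_ifs <;> assumption
  have hupd : ∀ x y y', Function.update (prof x y) j y' = prof x y' := by
    intro x y y'
    funext d
    by_cases hd : d = j
    · subst hd
      simp [prof]
    · simp [prof, hd]
  have pj : ∀ x y, prof x y j = y := fun x y => by simp [prof]
  have pi : ∀ x y, prof x y i = x := fun x y => by simp [prof, hji.symm]
  have pc : ∀ x y, prof x y c = E := fun x y => by simp [prof, hcj, hci]
  -- the profile in which `j` has valuation `w`
  have hC1 := hprof t ht w hwC
  have hwin := h.val_pos_of_gap hC1 hK hρ (j := j) (l := a + 1) (by rw [pj]; exact hw) (by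
    intro d hd
    simp only [prof, hd, if_false]
    split_ifs
    · exact hta.trans (mono (by omega))
    · exact hEu.le
    · exact hZu.le.trans (mono (by omega)))
  have hlose := h.bundle_eq_empty_of_gap (hprof t ht Z hZC) hK hρ (j := c) (l := a)
    (pc t Z) le_rfl (by
      intro d hd
      simp only [prof, hd, if_false]
      split_ifs
      · exact hZu.le.trans (mono hY)
      · exact hta
      · exact hZu.le.trans (mono hY)) hcj.symm
  have hir := h.profit_update_le (i := j) (hC1 j) Z
  rw [hupd, h.profit_eq_zero hlose] at hir
  -- the profile in which `i` forces `j` to lose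
  have hlose2 := h.bundle_eq_empty_of_gap (hprof A hAC B hBC) hK hρ (j := i) (l := l)
    (pi A B) le_rfl (by
      intro d hd
      simp only [prof, hd, if_false]
      split_ifs
      · exact hBu.le
      · exact hEu.le.trans (mono hal)
      · exact hZu.le.trans (mono (by omega))) hji
  have key := h.profit_le_of_message_ne (v := prof A B) (v' := prof t w) (i := j)
    (by rw [pj]; exact hBC) (by rw [pj, pj]; exact hne) (by
      intro d hd
      by_cases hdi : d = i
      · subst hdi
        rw [pi, pi, hmsg]
      · simp [prof, hd, hdi])
  rw [h.profit_eq_zero hlose2] at key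
  rw [pj] at key hwin hir
  rw [profit] at key hir
  have hS : ((node k next).run fun d => S d (prof t w d)).alloc.bundle j ∈
      (UpFamily.nonempty m hm).carrier := by
    refine Finset.nonempty_iff_ne_empty.2 fun h0 => ?_
    rw [h0, w.empty] at hwin
    exact hwin.false
  rw [hB, UpFamily.val_of_mem _ _ hS] at key
  have := w.val_le_univ (((node k next).run fun d => S d (prof t w d)).alloc.bundle j)
  linarith

/-- If some bidder does not tell apart a low valuation and the highest one, then no bidder reveals
anything about his valuation at this vertex. -/
theorem message_const_of_unsplit (h : (node k next).Solves S (between m b K Y L) ρ)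
    (hK : IsScale n b L ρ K) (hρ : 0 ≤ ρ) (hm : 0 < m) (hn : 3 ≤ n) (hYL : Y + 13 ≤ L) {i : Fin n}
    {t : GeneralValuation m b}
    (ht : t ∈ between m b K Y L) (hta : t.val Finset.univ ≤ K (Y + 1))
    (hmsg : (S i t).1 = (S i ((UpFamily.grand m hm).valuation (K L) (hK.describable _ le_rfl))).1)
    (x : Fin n) {w : GeneralValuation m b} (hw : w ∈ between m b K (Y + 10) L) :
    (S x w).1 =
      (S x ((UpFamily.nonempty m hm).valuation (K (L - 3)) (hK.describable _ (by omega)))).1 := by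
  have mono := hK.strictMono.monotone
  obtain ⟨l, rfl⟩ : ∃ l, L = l + 3 := ⟨L - 3, by omega⟩
  simp only [Nat.add_sub_cancel]
  -- All bidders except `i` send constant messages on the middle scales. In `step2` one of them
  -- takes over the role of `i`, so that `i` is covered as well.
  have step1 : ∀ j, j ≠ i → ∀ w : GeneralValuation m b, K (Y + 3) ≤ w.val Finset.univ →
      w.val Finset.univ < K (l + 2) → _ := fun j hj w hw1 hw2 =>
    h.message_eq_of_unsplit hK hρ hm hn (a := Y + 1) (l := l + 2) ht hta (by omega) (by omega)
      le_rfl hmsg hj hw1 hw2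
  have step2 : ∀ x : Fin n, ∀ w : GeneralValuation m b, K (Y + 5) ≤ w.val Finset.univ →
      w.val Finset.univ < K l →
      (S x w).1 =
        (S x ((UpFamily.nonempty m hm).valuation (K l) (hK.describable _ (by omega)))).1 := by
    intro x w hw1 hw2
    obtain ⟨j, hji, hjx⟩ : ∃ j : Fin n, j ≠ i ∧ j ≠ x := by
      by_contra! hc
      have : (Finset.univ : Finset (Fin n)) ⊆ {i, x} := fun y _ => by
        by_cases hy : y = i
        · simp [hy]
        · simp [hc y hy]
      have := (Finset.card_le_card this).trans Finset.card_le_two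
      simp at this
      omega
    refine h.message_eq_of_unsplit hK hρ hm hn (i := j) (a := Y + 3) (l := l)
      (t := (UpFamily.grand m hm).valuation (K (Y + 3)) (hK.describable _ (by omega)))
      (UpFamily.valuation_mem_between hK _ (by omega) (by omega)) (UpFamily.val_univ _ _).le
      (by omega) (by omega) (by omega) ?_ hjx.symm hw1 hw2
    have step : ∀ a (ha : a < l + 2), Y + 3 ≤ a → _ := fun a ha hY =>
      step1 j hji ((UpFamily.grand m hm).valuation (K a) (hK.describable _ (by omega)))
        (by rw [UpFamily.val_univ]; exact mono hY)
        (by rw [UpFamily.val_univ]; exact hK.strictMono ha)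
    exact (step (Y + 3) (by omega) le_rfl).trans (step (l + 1) (by omega) (by omega)).symm
  -- It remains to allow values from `K l` up to `K L`, where a price bounded by the value is
  -- useless. Instead the price is bounded by what the competition of the other bidders permits.
  by_contra hne
  obtain ⟨c, hcx⟩ : ∃ c : Fin n, c ≠ x := by
    have : Nontrivial (Fin n) := Fin.nontrivial_iff_two_le.2 (by omega)
    exact exists_ne x
  let T : ∀ a, a ≤ 10 → GeneralValuation m b := fun a ha =>
    (UpFamily.grand m hm).valuation (K (Y + a)) (hK.describable _ (by omega))
  have hT : ∀ a ha, T a ha ∈ between m b K Y (l + 3) := fun a ha =>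
    UpFamily.valuation_mem_between hK _ (by omega) (by omega)
  have hTu : ∀ a ha, (T a ha).val Finset.univ = K (Y + a) := fun a ha => UpFamily.val_univ _ _
  set B : GeneralValuation m b :=
    (UpFamily.nonempty m hm).valuation (K (Y + 8)) (hK.describable _ (by omega)) with hB
  have hBC : B ∈ between m b K Y (l + 3) :=
    UpFamily.valuation_mem_between hK _ (by omega) (by omega)
  have hBu : B.val Finset.univ = K (Y + 8) := UpFamily.val_univ _ _
  have hwC : w ∈ between m b K Y (l + 3) := ⟨(mono (by omega)).trans hw.1, hw.2⟩
  let prof : GeneralValuation m b → GeneralValuation m b → Fin n → GeneralValuation m b :=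
    fun e y d => if d = x then y else if d = c then e else T 5 (by omega)
  have hprof : ∀ e ∈ between m b K Y (l + 3), ∀ y ∈ between m b K Y (l + 3), ∀ d,
      prof e y d ∈ between m b K Y (l + 3) := by
    intro e he y hy d
    simp only [prof]
    split_ifs
    · exact hy
    · exact he
    · exact hT _ (by omega)
  have hupd : ∀ e y y', Function.update (prof e y) x y' = prof e y' := by
    intro e y y'
    funext d
    by_cases hd : d = x
    · subst hd
      simp [prof]
    · simp [prof, hd]
  have px : ∀ e y, prof e y x = y := fun e y => by simp [prof]
  have pc : ∀ e y, prof e y c = e := fun e y => by simp [prof, hcx]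
  have hothers : ∀ a ha y d, 5 ≤ a → d ≠ x →
      (prof (T a ha) y d).val Finset.univ ≤ K (Y + a) := by
    intro a ha y d h5 hd
    simp only [prof, hd, if_false]
    split_ifs
    · exact (hTu _ (by omega)).le
    · exact (hTu _ (by omega)).le.trans (mono (by omega))
  have h6 := hT 6 (by omega)
  have hlose := h.bundle_eq_empty_of_gap (hprof _ h6 _ (hT 0 (by omega))) hK hρ (j := c)
    (l := Y + 5) (pc _ _) le_rfl (by
      intro d hd
      simp only [prof, hd, if_false]
      split_ifs
      · exact (hTu _ (by omega)).le.trans (mono (by omega))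
      · exact (hTu _ (by omega)).le) hcx.symm
  have hwin7 := h.bundle_eq_univ_of_gap (hprof _ h6 _ (hT 7 (by omega))) hK hρ (j := x)
    (l := Y + 6) (px _ _) le_rfl fun d hd => hothers 6 (by omega) _ d (by omega) hd
  have hir := h.profit_update_le (i := x) (hprof _ h6 _ (hT 7 (by omega)) x) (T 0 (by omega))
  rw [hupd, h.profit_eq_zero hlose, px, profit, hwin7, hTu 7 (by omega)] at hir
  -- Pretending to be `T 7` buys everything for at most `K (Y + 7)`. So `w` pays at most that,
  -- however large its value, and `B` of value `K (Y + 8)` would profit from the same outcome.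
  have hmenu := h.profit_update_le (i := x) (hprof _ h6 _ hwC x) (T 7 (by omega))
  rw [hupd, px, profit, hwin7, profit] at hmenu
  have hw7 : K (Y + 7) < w.val Finset.univ := (hK.strictMono (by omega)).trans_le hw.1
  have hlose2 := h.bundle_eq_empty_of_gap (hprof _ (hT 9 (by omega)) B hBC) hK hρ (j := c)
    (l := Y + 8) (pc _ _) le_rfl (by
      intro d hd
      simp only [prof, hd, if_false]
      split_ifs
      · exact hBu.le
      · exact (hTu _ (by omega)).le.trans (mono (by omega))) hcx.symm
  have hz : ∀ d a (ha : a ≤ 9), 5 ≤ a → (S d (T a (by omega))).1 =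
      (S d ((UpFamily.nonempty m hm).valuation (K l) (hK.describable _ (by omega)))).1 := by
    intro d a ha h5
    refine step2 d _ ?_ ?_ <;> rw [hTu a (by omega)]
    · exact mono (by omega)
    · exact hK.strictMono (by omega)
  have key := h.profit_le_of_message_ne (v := prof (T 9 (by omega)) B)
    (v' := prof (T 6 (by omega)) w) (i := x) (by rw [px]; exact hBC) (by
      rw [px, px, step2 x B]
      · exact hne
      · rw [hBu]
        exact mono (by omega)
      · rw [hBu]
        exact hK.strictMono (by omega)) (by
      intro d hd
      simp only [prof, hd, if_false]
      split_ifs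
      · rw [hz _ _ (by omega) (by omega), hz _ _ (by omega) (by omega)]
      · rfl)
  rw [h.profit_eq_zero hlose2, px, profit] at key
  have hS : ((node k next).run fun d => S d (prof (T 6 (by omega)) w d)).alloc.bundle x ∈
      (UpFamily.nonempty m hm).carrier := by
    refine Finset.nonempty_iff_ne_empty.2 fun h0 => ?_
    have := h.normalized.run _ x h0
    rw [this, h0, w.empty] at hmenu
    linarith
  rw [hB, UpFamily.val_of_mem _ _ hS] at key
  have := w.val_le_univ
    (((node k next).run fun d => S d (prof (T 6 (by omega)) w d)).alloc.bundle x)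
  have := hK.strictMono (show Y + 7 < Y + 8 by omega)
  linarith

/-- A bidder who wins at a price other than his value, and could have received nothing, has, for
some valuation with the same message, a guaranteed win once the messages at the vertex are sent. -/
theorem exists_guaranteed_win (h : (node k next).Solves S (between m b K Y L) ρ)
    (hK : IsScale n b L ρ K) (hρ : 0 ≤ ρ) (hm : 0 < m) (hYL : Y + 13 ≤ L) {i : Fin n}
    (hsplit : ∀ t ∈ between m b K Y L, t.val Finset.univ ≤ K (Y + 1) →
      (S i t).1 ≠ (S i ((UpFamily.grand m hm).valuation (K L) (hK.describable _ le_rfl))).1)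
    {v : Fin n → GeneralValuation m b} (hv : ∀ j, v j ∈ between m b K Y L)
    (hv1 : ∀ j, (v j).val Finset.univ ≤ K (Y + 1)) {F : UpFamily m} {c : ℝ}
    {hc : IsDescribable b c} (hvi : v i = F.valuation c hc)
    (hwin : ((node k next).run fun j => S j (v j)).alloc.bundle i ∈ F.carrier)
    (hprice : ((node k next).run fun j => S j (v j)).price i ≠ c)
    (hlose : ∃ w ∈ between m b K Y L,
      ((node k next).run fun j => S j (Function.update v i w j)).alloc.bundle i = ∅) :
    ∃ (c' : ℝ) (hc' : IsDescribable b c'), (S i (F.valuation c' hc')).1 = (S i (v i)).1 ∧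
      (c' = c ∨ c' = K (Y + 3)) ∧
      ∀ τ : ∀ j, (next fun j => (S j (v j)).1).Plan j,
        τ i = (S i (F.valuation c' hc')).2 (fun j => (S j (v j)).1) →
        ((next fun j => (S j (v j)).1).run τ).alloc.bundle i ∈ F.carrier := by
  have mono := hK.strictMono.monotone
  set o := (node k next).run fun j => S j (v j) with ho
  set z : ∀ j, Fin (k j + 1) := fun j => (S j (v j)).1 with hz
  have hcpos : 0 < c := by
    have := (hv i).1
    rw [hvi, UpFamily.val_univ] at this
    exact (hK.pos Y).trans_le this
  have hc1 : c ≤ K (Y + 1) := by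
    have := hv1 i
    rwa [hvi, UpFamily.val_univ] at this
  obtain ⟨w, hw, hlose⟩ := hlose
  -- The losing report `w` has profit zero, so truthful play of any valuation is individually
  -- rational against these opponents.
  have ir : ∀ y ∈ between m b K Y L,
      0 ≤ profit i y ((node k next).run fun j => S j (Function.update v i y j)) := by
    intro y hy
    have := h.profit_update_le (v := Function.update v i y) (i := i) (by simpa using hy) w
    rwa [Function.update_idem, h.profit_eq_zero hlose, Function.update_self] at this
  have hpc : o.price i < c := by
    refine lt_of_le_of_ne ?_ hprice
    have := ir (v i) (hv i)
    rw [Function.update_eq_self, profit, hvi, ← ho, UpFamily.val_of_mem _ _ hwin] at this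
    linarith
  set v' : GeneralValuation m b := F.valuation (K (Y + 3)) (hK.describable _ (by omega)) with hv'
  have hv'C : v' ∈ between m b K Y L := UpFamily.valuation_mem_between hK _ (by omega) (by omega)
  have hmem : ∀ (y : ℝ) (hy : IsDescribable b y) (o' : Outcome n m), 0 ≤ o'.price i →
      0 < profit i (F.valuation y hy) o' → o'.alloc.bundle i ∈ F.carrier := by
    intro y hy o' h0 hp
    rw [profit] at hp
    exact F.mem_of_val_pos hy (by linarith)
  -- If `v'` shares the message, `hsplit` puts the report `A` behind a different one. It buys
  -- everything at the price that `E` pays or less, hence for at most `K (Y + 2)`, so `v'` must make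
  -- a positive profit at every outcome of his plan below `z`.
  by_cases hmsg : (S i v').1 = (S i (v i)).1
  · refine ⟨K (Y + 3), hK.describable _ (by omega), hmsg, Or.inr rfl, fun τ hτ => ?_⟩
    set A : GeneralValuation m b :=
      (UpFamily.grand m hm).valuation (K L) (hK.describable _ le_rfl) with hA
    have hAC : A ∈ between m b K Y L := UpFamily.valuation_mem_between hK _ (by omega) (by omega)
    set E : GeneralValuation m b :=
      (UpFamily.grand m hm).valuation (K (Y + 2)) (hK.describable _ (by omega)) with hE
    have hEC : E ∈ between m b K Y L := UpFamily.valuation_mem_between hK _ (by omega) (by omega)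
    have hupC : ∀ y ∈ between m b K Y L, ∀ j, Function.update v i y j ∈ between m b K Y L := by
      intro y hy j
      by_cases hj : j = i
      · subst hj
        simpa using hy
      · simpa [hj] using hv j
    have hgetE := h.bundle_eq_univ_of_gap (hupC E hEC) hK hρ (j := i) (l := Y + 1)
      (Function.update_self ..) le_rfl fun j hj => by simpa [hj] using hv1 j
    have hgetA := h.bundle_eq_univ_of_gap (hupC A hAC) hK hρ (j := i) (l := Y + 1)
      (Function.update_self ..) (mono (by omega)) fun j hj => by simpa [hj] using hv1 j
    have h1 := ir E hEC
    rw [profit, hgetE, hE, UpFamily.val_univ] at h1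
    have h2 := h.profit_update_le (v := Function.update v i A) (i := i)
      (by simpa using hAC) E
    rw [Function.update_idem, Function.update_self, profit, profit, hgetA, hgetE] at h2
    have hne : (S i A).1 ≠ z i := (hsplit (v i) (hv i) (hv1 i)).symm
    let z' : ∀ j, Fin (k j + 1) := fun j => (S j (Function.update v i A j)).1
    have hrun := run_node (next := next) (fun j => S j (Function.update v i A j)) z' fun j => rfl
    have key := (h.dominant i v' hv'C).le_of_message_ne (z := z) (z' := z') hmsg
      (by simpa [z'] using hne) (fun j hj => by simp [z', z, hj]) τ hτ
      fun j => (S j (Function.update v i A j)).2 z'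
    rw [← hrun, profit, hgetA, hv', UpFamily.val_univ] at key
    refine hmem _ _ _ ?_ (lt_of_lt_of_le ?_ key)
    · exact EveryLeaf.run (h.noNegativeTransfers z) τ i
    · have := hK.strictMono (show Y + 2 < Y + 3 by omega)
      rw [← hE, ← hA] at *
      linarith
  -- With different messages, profit is compared twice. The valuation `v'` must do as well below
  -- `z'` as with the outcome `o`, so it wins there at a price below `c`. That outcome in turn would
  -- give `v i` a positive profit, so his plan below `z` always yields one.
  · refine ⟨c, hc, by rw [hvi], Or.inl rfl, fun τ hτ => ?_⟩
    let z' : ∀ j, Fin (k j + 1) := fun j => (S j (Function.update v i v' j)).1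
    have hz'i : z' i = (S i v').1 := by simp [z']
    have hoff : ∀ j, j ≠ i → z' j = z j := fun j hj => by simp [z', z, hj]
    have hrun := run_node (next := next) (fun j => S j (v j)) z fun j => rfl
    let τ' : ∀ j, (next z').Plan j := fun j => (S j (Function.update v i v' j)).2 z'
    have key := (h.dominant i v' hv'C).le_of_message_ne (z := z') (z' := z) hz'i.symm
      (by rw [hz'i]; exact Ne.symm hmsg) (fun j hj => (hoff j hj).symm) τ'
      (by simp [τ']) fun j => (S j (v j)).2 z
    rw [← hrun, ← ho, profit, hv', UpFamily.val_of_mem _ _ hwin] at key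
    have h13 := hK.strictMono (show Y + 1 < Y + 3 by omega)
    have hmem' : ((next z').run τ').alloc.bundle i ∈ F.carrier :=
      hmem (K (Y + 3)) (hK.describable _ (by omega)) _
        (EveryLeaf.run (h.noNegativeTransfers z') τ' i) (by linarith)
    rw [profit, UpFamily.val_of_mem _ _ hmem'] at key
    have key2 := (h.dominant i (v i) (hv i)).le_of_message_ne (z := z) (z' := z') rfl
      (by rw [hz'i]; exact hmsg) hoff τ (by rw [hτ, hvi]) τ'
    rw [hvi, profit, UpFamily.val_of_mem _ _ hmem'] at key2
    exact hmem c hc _ (EveryLeaf.run (h.noNegativeTransfers z) τ i) (by linarith)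

end Mechanism.Solves

/-! ### Averaging over one coordinate, and bias caused by short messages -/

-- Resampling one coordinate preserves the uniform distribution: exchanging `ω i` with the fresh
-- value `y` is an involution on pairs.
open Finset in
theorem Fintype.sum_sum_update {ι X : Type*} [Fintype ι] [DecidableEq ι] [Fintype X] (i : ι)
    (f : (ι → X) → ℝ) :
    ∑ ω : ι → X, ∑ y : X, f (Function.update ω i y) = Fintype.card X * ∑ ω, f ω := by
  classical
  rw [← Fintype.sum_prod_type']
  have : ∑ p : (ι → X) × X, f (Function.update p.1 i p.2) = ∑ p : (ι → X) × X, f p.1 := by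
    refine Fintype.sum_bijective (fun p => (Function.update p.1 i p.2, p.1 i)) ?_ _ _ fun _ => rfl
    refine Function.Involutive.bijective fun p => ?_
    simp
  rw [this, Fintype.sum_prod_type]
  simp [Finset.mul_sum]

open Finset in
/-- A bound on conditional probabilities, given all coordinates but one, holds on average. -/
theorem Fintype.card_filter_le_of_update {ι X : Type*} [Fintype ι] [DecidableEq ι] [Fintype X]
    [Nonempty X] (i : ι) (E E' : (ι → X) → Prop) [DecidablePred E] [DecidablePred E'] (r : ℝ)
    (h : ∀ ω, (#{y | E (Function.update ω i y)} : ℝ) ≤ r * #{y | E' (Function.update ω i y)}) :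
    (#{ω | E ω} : ℝ) ≤ r * #{ω | E' ω} := by
  have hX : (0 : ℝ) < Fintype.card X := by exact_mod_cast Fintype.card_pos
  have h1 := Fintype.sum_sum_update i fun ω => if E ω then (1 : ℝ) else 0
  have h2 := Fintype.sum_sum_update i fun ω => if E' ω then (1 : ℝ) else 0
  simp only [Finset.sum_boole] at h1 h2
  have h3 := Finset.sum_le_sum fun ω (_ : ω ∈ (univ : Finset (ι → X))) => h ω
  rw [← Finset.mul_sum, h1, h2] at h3
  refine le_of_mul_le_mul_left ?_ hX
  linarith

section bias

variable {α I : Type*} [Fintype α] [DecidableEq α] [Fintype I] {q : ℕ} [NeZero q]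

open Finset

/-- The exponential moment of the number of zeros factors over the independent coordinates; those
outside `B` contribute `q` each. -/
theorem sum_exp_card_zeros (B : Finset α) :
    ∑ x : α → Fin q, Real.exp #{a ∈ B | x a = 0} = (q - 1 + Real.exp 1) ^ #B * q ^ #Bᶜ := by
  have h1 : ∀ x : α → Fin q, Real.exp #{a ∈ B | x a = 0} =
      ∏ a, if a ∈ B ∧ x a = 0 then Real.exp 1 else 1 := by
    intro x
    rw [Finset.prod_ite, Finset.prod_const, Finset.prod_const_one, mul_one, ← Real.exp_nat_mul,
      mul_one]
    congr 3
    ext a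
    simp
  simp_rw [h1]
  rw [← Fintype.piFinset_univ,
    ← Finset.prod_univ_sum (fun _ : α => (univ : Finset (Fin q)))
      (fun a (j : Fin q) => if a ∈ B ∧ j = 0 then Real.exp 1 else 1),
    ← Finset.prod_mul_prod_compl B]
  congr 1
  · rw [Finset.prod_congr rfl (g := fun _ => (q - 1 + Real.exp 1)), Finset.prod_const]
    intro a ha
    simp only [ha, true_and]
    have : ∀ j : Fin q, (if j = 0 then Real.exp 1 else 1) =
        1 + if j = 0 then Real.exp 1 - 1 else 0 := by
      intro j
      split_ifs <;> ring
    simp_rw [this]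
    rw [Finset.sum_add_distrib, Finset.sum_ite_eq' univ (0 : Fin q)]
    simp
    ring
  · rw [Finset.prod_congr rfl (g := fun _ => (q : ℝ)), Finset.prod_const]
    intro a ha
    simp [Finset.mem_compl.1 ha]

/-- If many coordinates are biased on `D`, then `D` is small. -/
theorem card_biased_le {D : Finset ((α → Fin q) × I)} (hD : D.Nonempty) (B : Finset α)
    (hB : ∀ a ∈ B, 3 * #D ≤ q * #{y ∈ D | y.1 a = 0}) :
    (#B : ℝ) ≤ q * Real.log (Fintype.card ((α → Fin q) × I) / #D) := by
  have hq : (0 : ℝ) < q := by exact_mod_cast Nat.pos_of_ne_zero (NeZero.ne q)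
  have hDpos : (0 : ℝ) < #D := by exact_mod_cast hD.card_pos
  set N : ((α → Fin q) × I) → ℝ := fun y => #{a ∈ B | y.1 a = 0} with hN
  set r : ℝ := 3 * #B / q with hr
  have h1 : r * #D ≤ ∑ y ∈ D, N y := by
    have e : ∑ y ∈ D, N y = ∑ a ∈ B, (#{y ∈ D | y.1 a = 0} : ℝ) := by
      simp only [hN, Finset.card_filter, Nat.cast_sum]
      exact Finset.sum_comm
    rw [e]
    have : ∑ _a ∈ B, (3 * #D / q : ℝ) ≤ ∑ a ∈ B, (#{y ∈ D | y.1 a = 0} : ℝ) := by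
      refine Finset.sum_le_sum fun a ha => ?_
      rw [div_le_iff₀ hq, mul_comm _ (q : ℝ)]
      exact_mod_cast hB a ha
    refine le_trans (le_of_eq ?_) this
    rw [Finset.sum_const, nsmul_eq_mul, hr]
    ring
  -- Jensen's inequality through the tangent of `exp` at `r`, since `N` has average at least `r` on
  -- `D`.
  have h2 : Real.exp r * #D ≤ ∑ y ∈ D, Real.exp (N y) := by
    calc Real.exp r * #D ≤ Real.exp r * (#D + (∑ y ∈ D, N y - r * #D)) := by
          gcongr
          linarith
      _ = ∑ y ∈ D, Real.exp r * (1 + (N y - r)) := by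
          rw [← Finset.mul_sum, Finset.sum_add_distrib, Finset.sum_sub_distrib]
          simp
          ring_nf
      _ ≤ ∑ y ∈ D, Real.exp (N y) := by
          refine Finset.sum_le_sum fun y _ => ?_
          have := Real.add_one_le_exp (N y - r)
          calc Real.exp r * (1 + (N y - r)) ≤ Real.exp r * Real.exp (N y - r) := by
                gcongr
                linarith
            _ = Real.exp (N y) := by
                rw [← Real.exp_add]
                ring_nf
  have h3 : ∑ y ∈ D, Real.exp (N y) ≤ ∑ y, Real.exp (N y) :=
    Finset.sum_le_sum_of_subset_of_nonneg (Finset.subset_univ _) fun _ _ _ => (Real.exp_pos _).le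
  have h4 : ∑ y, Real.exp (N y) =
      Fintype.card ((α → Fin q) × I) * ((q - 1 + Real.exp 1) / q) ^ #B := by
    rw [Fintype.sum_prod_type_right]
    simp only [hN]
    rw [sum_exp_card_zeros, Finset.sum_const, nsmul_eq_mul, Fintype.card_prod, Fintype.card_fun,
      Fintype.card_fin, Finset.card_univ, div_pow, ← Finset.card_add_card_compl B]
    push_cast
    rw [pow_add]
    field_simp
  -- Here `e - 1 < 2` is used. The bias factor `3` exceeds this `2`, which leaves `exp (#B / q)` as
  -- the gain.
  have h5 : ((q - 1 + Real.exp 1) / q) ^ #B ≤ Real.exp (2 * #B / q) := by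
    have : (q - 1 + Real.exp 1) / q ≤ Real.exp (2 / q) := by
      have e1 : (q - 1 + Real.exp 1) / q ≤ 2 / q + 1 := by
        rw [div_add_one hq.ne', div_le_div_iff_of_pos_right hq]
        have := Real.exp_one_lt_d9
        linarith
      exact e1.trans (Real.add_one_le_exp _)
    have hpos : 0 ≤ (q - 1 + Real.exp 1) / q := by
      have := Real.exp_one_gt_d9
      apply div_nonneg _ hq.le
      linarith
    calc _ ≤ (Real.exp (2 / q)) ^ #B := pow_le_pow_left₀ hpos this _
      _ = _ := by
          rw [← Real.exp_nat_mul]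
          ring_nf
  have h6 : Real.exp (#B / q) ≤ Fintype.card ((α → Fin q) × I) / #D := by
    rw [le_div_iff₀ hDpos]
    have h7 : Real.exp r * #D ≤
        Fintype.card ((α → Fin q) × I) * Real.exp (2 * #B / q) := by
      calc _ ≤ _ := h2.trans h3
        _ = _ := h4
        _ ≤ _ := by gcongr
    have h8 : Real.exp r = Real.exp (#B / q) * Real.exp (2 * #B / q) := by
      rw [← Real.exp_add, hr]
      ring_nf
    rw [h8] at h7
    refine le_of_mul_le_mul_right ?_ (Real.exp_pos (2 * #B / q))
    linarith
  rw [← div_le_iff₀' hq]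
  calc (#B : ℝ) / q = Real.log (Real.exp (#B / q)) := (Real.log_exp _).symm
    _ ≤ _ := Real.log_le_log (Real.exp_pos _) h6

/-- Under the condition that `f` takes the same value as at `y`, the coordinate `a` is biased
towards `0`. -/
def Biased {κ : ℕ} (f : (α → Fin q) × I → Fin κ) (a : α) (y : (α → Fin q) × I) : Prop :=
  3 * #{y' | f y' = f y} < q * #{y' | f y' = f y ∧ y'.1 a = 0}

open Classical in
/-- A function with few values biases few coordinates on average. -/
theorem sum_card_biased_le [Nonempty I] {κ : ℕ} (f : (α → Fin q) × I → Fin κ) (B : Finset α) :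
    (∑ a ∈ B, #{y | Biased f a y} : ℝ) ≤
      Fintype.card ((α → Fin q) × I) * (q * Real.log κ) := by
  have hq : (0 : ℝ) < q := by exact_mod_cast Nat.pos_of_ne_zero (NeZero.ne q)
  have hX : (0 : ℝ) < Fintype.card ((α → Fin q) × I) := by exact_mod_cast Fintype.card_pos
  have hκ : (0 : ℝ) < κ := by
    have : Nonempty (Fin κ) := ⟨f (Classical.arbitrary _)⟩
    exact_mod_cast Fin.pos_iff_nonempty.2 this
  let D : Fin κ → Finset ((α → Fin q) × I) := fun ζ => {y | f y = ζ}
  let bad : Fin κ → Finset α := fun ζ => {a ∈ B | 3 * #(D ζ) < q * #{y ∈ D ζ | y.1 a = 0}}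
  have hD : ∑ ζ, (#(D ζ) : ℝ) = Fintype.card ((α → Fin q) × I) := by
    have := Finset.card_eq_sum_card_fiberwise (s := (univ : Finset ((α → Fin q) × I))) (t := univ) (f := f)
      fun _ _ => by simp
    rw [← Finset.card_univ, this]
    push_cast
    rfl
  have h1 : (∑ a ∈ B, #{y | Biased f a y} : ℝ) = ∑ ζ, (#(D ζ) * #(bad ζ) : ℝ) := by
    have e1 : ∀ a, (#{y | Biased f a y} : ℝ) =
        ∑ ζ, if 3 * #(D ζ) < q * #{y ∈ D ζ | y.1 a = 0} then (#(D ζ) : ℝ) else 0 := by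
      intro a
      rw [Finset.card_eq_sum_card_fiberwise (s := ({y | Biased f a y} : Finset ((α → Fin q) × I))) (t := univ)
        (f := f) fun _ _ => by simp]
      push_cast
      refine Finset.sum_congr rfl fun ζ _ => ?_
      rw [Finset.filter_filter]
      split_ifs with hζ
      · congr 2
        ext y
        simp only [D, mem_filter, mem_univ, true_and, and_iff_right_iff_imp]
        rintro rfl
        simpa only [Biased, D, Finset.filter_filter] using hζ
      · rw [Nat.cast_eq_zero, Finset.card_eq_zero, Finset.filter_eq_empty_iff]
        rintro y - ⟨hy, rfl⟩
        exact hζ (by simpa only [Biased, D, Finset.filter_filter] using hy)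
    simp_rw [e1]
    rw [Finset.sum_comm]
    refine Finset.sum_congr rfl fun ζ _ => ?_
    rw [← Finset.sum_filter, Finset.sum_const, nsmul_eq_mul, mul_comm]
  rw [h1]
  have h2 : ∀ ζ, (#(D ζ) * #(bad ζ) : ℝ) ≤
      q * (#(D ζ) * Real.log κ + (Fintype.card ((α → Fin q) × I) / κ - #(D ζ))) := by
    intro ζ
    rcases (D ζ).eq_empty_or_nonempty with h0 | h0
    · simp only [h0, card_empty, Nat.cast_zero, zero_mul, zero_add, sub_zero]
      positivity
    have hpos : (0 : ℝ) < #(D ζ) := by exact_mod_cast h0.card_pos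
    have h3 := card_biased_le h0 (bad ζ) fun a ha => (Finset.mem_filter.1 ha).2.le
    -- This is the bound of entropy by `log κ`: after weighting by `#(D ζ)`, the errors of `log t ≤
    -- t - 1` sum to zero over the fibres.
    have h4 : Real.log (Fintype.card ((α → Fin q) × I) / #(D ζ)) ≤
        Real.log κ + (Fintype.card ((α → Fin q) × I) / (κ * #(D ζ)) - 1) := by
      have e : (Fintype.card ((α → Fin q) × I) : ℝ) / #(D ζ) = κ * (Fintype.card ((α → Fin q) × I) / (κ * #(D ζ))) := by
        field_simp
      rw [e, Real.log_mul hκ.ne' (by positivity)]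
      have := Real.log_le_sub_one_of_pos (x := Fintype.card ((α → Fin q) × I) / (κ * #(D ζ))) (by positivity)
      linarith
    calc (#(D ζ) * #(bad ζ) : ℝ)
        ≤ #(D ζ) * (q * (Real.log κ + (Fintype.card ((α → Fin q) × I) / (κ * #(D ζ)) - 1))) := by
          gcongr
          exact h3.trans (by gcongr)
      _ = _ := by field_simp
  calc ∑ ζ, (#(D ζ) * #(bad ζ) : ℝ)
      ≤ ∑ ζ, q * (#(D ζ) * Real.log κ + (Fintype.card ((α → Fin q) × I) / κ - #(D ζ))) :=
        Finset.sum_le_sum fun ζ _ => h2 ζ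
    _ = _ := by
        rw [← Finset.mul_sum, Finset.sum_add_distrib, Finset.sum_sub_distrib, ← Finset.sum_mul, hD]
        simp only [sum_const, card_univ, Fintype.card_fin, nsmul_eq_mul]
        field_simp
        ring

end bias

/-! ### Random permutations of the items -/

section placement

open Finset

theorem exists_perm_map_eq {α : Type*} [Fintype α] [DecidableEq α] {G Q Q' : Finset α}
    (hQ : Q ⊆ G) (hQ' : Q' ⊆ G) (h : #Q = #Q') :
    ∃ σ : Equiv.Perm α, G.map σ.toEmbedding = G ∧ Q.map σ.toEmbedding = Q' := by
  have e : {x : G // (x : α) ∈ Q} ≃ {x : G // (x : α) ∈ Q'} := by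
    refine Fintype.equivOfCardEq ?_
    rw [Fintype.card_subtype, Fintype.card_subtype]
    have : ∀ P : Finset α, P ⊆ G → #{x : G | (x : α) ∈ P} = #P := by
      intro P hP
      rw [← Finset.card_map (Function.Embedding.subtype _)]
      congr 1
      ext x
      simp only [mem_map, mem_filter, mem_univ, true_and, Function.Embedding.subtype_apply,
        Subtype.exists]
      exact ⟨fun ⟨a, _, h1, h2⟩ => h2 ▸ h1, fun hx => ⟨x, hP hx, hx, rfl⟩⟩
    rw [this Q hQ, this Q' hQ', h]
  let σ : Equiv.Perm α := Equiv.Perm.ofSubtype (e.extendSubtype)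
  have hσ : ∀ x (hx : x ∈ G), σ x = (e.extendSubtype ⟨x, hx⟩ : G) := fun x hx =>
    Equiv.Perm.ofSubtype_apply_of_mem _ hx
  refine ⟨σ, ?_, ?_⟩
  · refine Finset.eq_of_subset_of_card_le ?_ (by simp)
    intro y hy
    obtain ⟨x, hx, rfl⟩ := Finset.mem_map.1 hy
    change σ x ∈ G
    rw [hσ x hx]
    exact Subtype.coe_prop _
  · refine Finset.eq_of_subset_of_card_le ?_ (by simp [h])
    intro y hy
    obtain ⟨x, hx, rfl⟩ := Finset.mem_map.1 hy
    change σ x ∈ Q'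
    rw [hσ x (hQ hx)]
    exact e.extendSubtype_mem ⟨x, hQ hx⟩ hx

/-- Under a random permutation all subsets of `G` of a given size are equally likely. -/
theorem choose_mul_sum_perm_le {α : Type*} [Fintype α] [DecidableEq α] {G Q : Finset α}
    (hQ : Q ⊆ G) (φ : Finset α → Finset α → ℝ) (C : ℝ)
    (hφ : ∀ G' : Finset α, ∑ Q' ∈ powersetCard #Q G', φ G' Q' ≤ C) :
    (#G).choose #Q * ∑ σ : Equiv.Perm α, φ (G.map σ.toEmbedding) (Q.map σ.toEmbedding) ≤
      (Fintype.card α).factorial * C := by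
  have h1 : ∀ Q' ∈ powersetCard #Q G,
      ∑ σ : Equiv.Perm α, φ (G.map σ.toEmbedding) (Q.map σ.toEmbedding) =
        ∑ σ : Equiv.Perm α, φ (G.map σ.toEmbedding) (Q'.map σ.toEmbedding) := by
    intro Q' hQ'
    rw [Finset.mem_powersetCard] at hQ'
    obtain ⟨τ, hG, hτ⟩ := exists_perm_map_eq hQ hQ'.1 hQ'.2.symm
    -- Precomposing with `τ` fixes `G` and moves `Q` to `Q'`, so every `Q'` gives the same sum and
    -- `Q` may be replaced by the average.
    rw [← Equiv.sum_comp (Equiv.mulRight τ)]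
    refine Finset.sum_congr rfl fun σ _ => ?_
    have : ∀ P : Finset α, P.map (Equiv.mulRight τ σ).toEmbedding =
        (P.map τ.toEmbedding).map σ.toEmbedding := by
      intro P
      rw [Finset.map_map]
      rfl
    rw [this, this, hG, hτ]
  have h2 := Finset.sum_congr rfl h1
  rw [Finset.sum_const, Finset.card_powersetCard, nsmul_eq_mul, Finset.sum_comm] at h2
  rw [h2]
  calc _ ≤ ∑ _σ : Equiv.Perm α, C := by
        refine Finset.sum_le_sum fun σ _ => ?_
        have := hφ (G.map σ.toEmbedding)
        rwa [Finset.powersetCard_map, Finset.sum_map] at this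
    _ = _ := by simp [Fintype.card_perm]

end placement

/-! ### The hard instance: common and special bundles -/

section

open Finset

section zeros

variable {α I : Type*} [Fintype α] [DecidableEq α] [Fintype I] {q : ℕ} [NeZero q]

theorem card_zero_le [Nonempty I] (a : α) :
    (#{y : (α → Fin q) × I | y.1 a = 0} : ℝ) ≤ 1 / q * Fintype.card ((α → Fin q) × I) := by
  have hq : (q : ℝ) ≠ 0 := by exact_mod_cast NeZero.ne q
  have h := Fintype.card_filter_le_of_update a (fun x : α → Fin q => x a = 0) (fun _ => True)
    (1 / q) (by
      intro x
      simp only [Function.update_self, filter_true, card_univ, Fintype.card_fin]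
      rw [Finset.filter_eq' univ (0 : Fin q), one_div_mul_cancel hq]
      simp)
  have e : ({y : (α → Fin q) × I | y.1 a = 0} : Finset _) =
      ({x : α → Fin q | x a = 0} : Finset _) ×ˢ (univ : Finset I) := by
    ext y
    simp
  rw [e, card_product, Fintype.card_prod]
  push_cast
  simp only [filter_true] at h
  rw [← mul_assoc, card_univ]
  rw [card_univ] at h
  gcongr

theorem card_nonzero_le [Nonempty I] (a : α) :
    (#{y : (α → Fin q) × I | y.1 a ≠ 0} : ℝ) ≤
      (1 - 1 / q) * Fintype.card ((α → Fin q) × I) := by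
  have hq : (q : ℝ) ≠ 0 := by exact_mod_cast NeZero.ne q
  have h := Fintype.card_filter_le_of_update a (fun x : α → Fin q => x a ≠ 0) (fun _ => True)
    (1 - 1 / q) (by
      intro x
      simp only [Function.update_self, filter_true, card_univ, Fintype.card_fin]
      rw [Finset.filter_ne' univ (0 : Fin q), card_erase_of_mem (mem_univ _), card_univ,
        Fintype.card_fin, Nat.cast_sub (Nat.pos_of_ne_zero (NeZero.ne q))]
      field_simp
      simp)
  have e : ({y : (α → Fin q) × I | y.1 a ≠ 0} : Finset _) =
      ({x : α → Fin q | x a ≠ 0} : Finset _) ×ˢ (univ : Finset I) := by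
    ext y
    simp
  rw [e, card_product, Fintype.card_prod]
  push_cast
  simp only [filter_true] at h
  rw [← mul_assoc, card_univ]
  rw [card_univ] at h
  gcongr

-- Condition on the value of `f`: the event `P` is then decided, and without bias the conditional
-- probability of a zero is at most `3 / q`.
open Classical in
theorem card_unbiased_le {κ : ℕ} (f : (α → Fin q) × I → Fin κ) (a : α) (P : Fin κ → Prop) :
    (#{y | P (f y) ∧ y.1 a = 0 ∧ ¬Biased f a y} : ℝ) ≤ 3 / q * #{y | P (f y)} := by
  have hq : (0 : ℝ) < q := by exact_mod_cast Nat.pos_of_ne_zero (NeZero.ne q)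
  rw [card_eq_sum_card_fiberwise (s := ({y | P (f y) ∧ y.1 a = 0 ∧ ¬Biased f a y} : Finset _))
      (t := univ) (f := f) fun _ _ => by simp,
    card_eq_sum_card_fiberwise (s := ({y | P (f y)} : Finset _))
      (t := univ) (f := f) fun _ _ => by simp]
  push_cast
  rw [mul_sum]
  refine sum_le_sum fun ζ _ => ?_
  simp only [filter_filter]
  rcases Finset.eq_empty_or_nonempty
    ({y | (P (f y) ∧ y.1 a = 0 ∧ ¬Biased f a y) ∧ f y = ζ} : Finset ((α → Fin q) × I)) with h0 | h0
  · rw [h0, card_empty, Nat.cast_zero]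
    positivity
  · obtain ⟨y, hy⟩ := h0
    simp only [mem_filter, mem_univ, true_and] at hy
    obtain ⟨⟨hP, -, hb⟩, rfl⟩ := hy
    rw [Biased, not_lt] at hb
    have hb' : (q : ℝ) * #{y' | f y' = f y ∧ y'.1 a = 0} ≤ 3 * #{y' | f y' = f y} := by
      exact_mod_cast hb
    have h1 : (#{y' | (P (f y') ∧ y'.1 a = 0 ∧ ¬Biased f a y') ∧ f y' = f y} : ℝ) ≤
        #{y' | f y' = f y ∧ y'.1 a = 0} := by
      exact_mod_cast card_le_card fun y' hy' => by
        simp only [mem_filter, mem_univ, true_and] at hy' ⊢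
        exact ⟨hy'.2, hy'.1.2.1⟩
    have h2 : (#{y' | f y' = f y} : ℝ) ≤ #{y' | P (f y') ∧ f y' = f y} := by
      exact_mod_cast card_le_card fun y' hy' => by
        simp only [mem_filter, mem_univ, true_and] at hy' ⊢
        exact ⟨hy' ▸ hP, hy'⟩
    rw [div_mul_eq_mul_div, le_div_iff₀ hq]
    nlinarith

open Classical in
/-- If there are at least `q` independent attempts, which succeed with probability at least `1 / q`
each, then the probability that all of them fail is at most `1 / 2`. -/
theorem card_forall_notMem_le {ι X : Type*} [Fintype ι] [DecidableEq ι] [Fintype X]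
    {N : Finset X} (hN : (#N : ℝ) ≤ (1 - 1 / q) * Fintype.card X) {J : Finset ι} (hJ : q ≤ #J) :
    (#{ω : ι → X | ∀ i ∈ J, ω i ∈ N} : ℝ) ≤ 1 / 2 * Fintype.card (ι → X) := by
  have hq : (1 : ℝ) ≤ q := by exact_mod_cast Nat.pos_of_ne_zero (NeZero.ne q)
  have e : ({ω : ι → X | ∀ i ∈ J, ω i ∈ N} : Finset (ι → X)) =
      Fintype.piFinset fun i => if i ∈ J then N else univ := by
    ext ω
    simp only [mem_filter, mem_univ, true_and, Fintype.mem_piFinset]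
    refine forall_congr' fun i => ?_
    by_cases hi : i ∈ J <;> simp [hi]
  have hr0 : 0 ≤ (1 - 1 / q : ℝ) := by
    rw [sub_nonneg, div_le_one (by linarith)]
    exact hq
  have hr1 : (1 - 1 / q : ℝ) ≤ 1 := by
    have : (0 : ℝ) ≤ 1 / q := by positivity
    linarith
  have h1 : (1 - 1 / q : ℝ) ^ #J ≤ 1 / 2 := by
    calc (1 - 1 / q : ℝ) ^ #J ≤ (1 - 1 / q : ℝ) ^ q := pow_le_pow_of_le_one hr0 hr1 hJ
      _ ≤ Real.exp (-1) := Real.one_sub_div_pow_le_exp_neg hq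
      _ ≤ 1 / 2 := by
        have := Real.exp_neg_one_lt_d9
        linarith
  rw [e, Fintype.card_piFinset]
  push_cast
  rw [← prod_mul_prod_compl J,
    prod_congr rfl (g := fun _ => (#N : ℝ)) fun i hi => by simp [hi],
    prod_congr (s₁ := Jᶜ) rfl (g := fun _ => (Fintype.card X : ℝ)) fun i hi => by
      simp [mem_compl.1 hi], prod_const, prod_const, Fintype.card_fun,
    ← card_add_card_compl J]
  push_cast
  rw [pow_add, ← mul_assoc]
  gcongr
  calc (#N : ℝ) ^ #J ≤ ((1 - 1 / q) * Fintype.card X) ^ #J := by gcongr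
    _ = (1 - 1 / q : ℝ) ^ #J * (Fintype.card X : ℝ) ^ #J := mul_pow _ _ _
    _ ≤ _ := by gcongr

end zeros

/-- Disjoint bundles use up different items of `U`. -/
theorem Allocation.card_meet_le {n m : ℕ} (A : Allocation n m) (J : Finset (Fin n))
    (U : Finset (Fin m)) (hJ : ∀ i ∈ J, ¬Disjoint (A.bundle i) U) : #J ≤ #U := by
  calc #J = ∑ i ∈ J, 1 := by simp
    _ ≤ ∑ i ∈ J, #(A.bundle i ∩ U) := by
        refine sum_le_sum fun i hi => ?_
        rw [Nat.succ_le_iff, card_pos, ← not_disjoint_iff_nonempty_inter]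
        exact hJ i hi
    _ = #(J.biUnion fun i => A.bundle i ∩ U) := by
        refine (card_biUnion fun i _ j _ hij => ?_).symm
        exact (A.disjoint i j hij).mono inter_subset_left inter_subset_left
    _ ≤ #U := card_le_card (biUnion_subset.2 fun i _ => inter_subset_right)

/-- The bundles that are the grand bundle or contain some `T ⊆ G` of size `s` with `x T = 0`. -/
def UpFamily.generated {m q s : ℕ} [NeZero q] (hm : 0 < m) (hs : 0 < s) (G : Finset (Fin m))
    (x : Finset (Fin m) → Fin q) : UpFamily m where
  carrier := {A | A = univ ∨ ∃ T, T ⊆ G ∧ #T = s ∧ x T = 0 ∧ T ⊆ A}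
  upper A B hAB hA := by
    rcases hA with rfl | ⟨T, h1, h2, h3, h4⟩
    · exact Or.inl (univ_subset_iff.1 hAB)
    · exact Or.inr ⟨T, h1, h2, h3, h4.trans hAB⟩
  empty_notMem h := by
    rcases h with h | ⟨T, -, h2, -, h4⟩
    · exact (UpFamily.grand m hm).empty_notMem h
    · rw [subset_empty.1 h4, card_empty] at h2
      omega
  univ_mem := Or.inl rfl

/-- A placement of a common bundle `U` and of `g` special bundles `Q u`, all of size `s`. -/
structure Placement (m g s : ℕ) where
  U : Finset (Fin m)
  Q : Fin g → Finset (Fin m)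
  card_U : #U = s
  card_Q : ∀ u, #(Q u) = s
  disjoint_U : ∀ u, Disjoint U (Q u)
  disjoint_Q : ∀ u u', u ≠ u' → Disjoint (Q u) (Q u')

namespace Placement

variable {m g s n q : ℕ} [NeZero q] (P : Placement m g s) (hm : 0 < m) (hs : 0 < s)
  (blk : Fin n → Fin g)

/-- The family of bundles that bidder `i` wants if his type is `x`. -/
def family (i : Fin n) (x : Finset (Fin m) → Fin q) : UpFamily m :=
  UpFamily.generated hm hs (P.U ∪ P.Q (blk i)) x

/-- A wanted `s`-subset of `U ∪ Q` that avoids `U` has room only to be `Q` itself. -/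
theorem subset_of_disjoint {i : Fin n} {x : Finset (Fin m) → Fin q} {A : Finset (Fin m)}
    (hA : A ∈ (P.family hm hs blk i x).carrier) (hU : Disjoint A P.U) :
    P.Q (blk i) ⊆ A ∧ x (P.Q (blk i)) = 0 := by
  rcases hA with rfl | ⟨T, h1, h2, h3, h4⟩
  · exfalso
    have h0 : P.U = ∅ := disjoint_self_iff_empty _ |>.1 (hU.mono_left (subset_univ _))
    have := P.card_U
    rw [h0, card_empty] at this
    omega
  · have hT : T ⊆ P.Q (blk i) := by
      intro a ha
      rcases mem_union.1 (h1 ha) with h | h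
      · exact absurd h (disjoint_left.1 hU (h4 ha))
      · exact h
    have : T = P.Q (blk i) := eq_of_subset_of_card_le hT (by rw [h2, P.card_Q])
    subst this
    exact ⟨h4, h3⟩

-- At most `s` bundles meet `U`. Each of the rest contains the special bundle of its group, so there
-- is at most one per group.
include hs in
theorem card_le (A : Allocation n m) (J : Finset (Fin n)) (x : Fin n → Finset (Fin m) → Fin q)
    (hJ : ∀ i ∈ J, A.bundle i ∈ (P.family hm hs blk i (x i)).carrier) : #J ≤ s + g := by
  classical
  rw [← card_filter_add_card_filter_not (s := J) fun i => ¬Disjoint (A.bundle i) P.U]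
  refine Nat.add_le_add ?_ ?_
  · exact (A.card_meet_le _ _ fun i hi => (mem_filter.1 hi).2).trans P.card_U.le
  · calc _ ≤ #(univ : Finset (Fin g)) := by
          refine card_le_card_of_injOn blk (fun _ _ => by simp) ?_
          intro i hi j hj hij
          simp only [not_not, coe_filter, Set.mem_ofPred_eq] at hi hj
          by_contra hne
          have hi' := (P.subset_of_disjoint hm hs blk (hJ i hi.1) hi.2).1
          have hj' := (P.subset_of_disjoint hm hs blk (hJ j hj.1) hj.2).1
          have h1 := (A.disjoint i j hne).mono hi' hj'
          rw [hij, Finset.disjoint_self_iff_empty] at h1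
          have := P.card_Q (blk j)
          rw [h1, card_empty] at this
          omega
      _ = g := by simp

end Placement

namespace Placement

variable {n m b L Y g s q Λ : ℕ} [NeZero q] {ρ : ℝ} {K : ℕ → ℝ}
  (P : Placement m g s) (hm : 0 < m) (hs : 0 < s) (blk : Fin n → Fin g)
  (hd : ∀ j : Fin Λ, IsDescribable b ((Λ + j) * K Y))

/-- The valuation of bidder `i` of type `y`. -/
noncomputable def valuation (i : Fin n) (y : (Finset (Fin m) → Fin q) × Fin Λ) :
    GeneralValuation m b :=
  (P.family hm hs blk i y.1).valuation ((Λ + y.2) * K Y) (hd y.2)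

theorem valuation_val_univ (i : Fin n) (y : (Finset (Fin m) → Fin q) × Fin Λ) :
    (P.valuation hm hs blk hd i y).val univ = (Λ + y.2) * K Y :=
  UpFamily.val_univ _ _

section bounds

variable (hK : IsScale n b L ρ K) (i : Fin n) (y : (Finset (Fin m) → Fin q) × Fin Λ)
include hK

theorem valuation_val_univ_le : (P.valuation hm hs blk hd i y).val univ ≤ 2 * Λ * K Y := by
  rw [valuation_val_univ]
  have h1 : ((y.2 : ℕ) : ℝ) ≤ Λ := by exact_mod_cast y.2.2.le
  have := hK.pos Y
  nlinarith

theorem le_valuation_val_univ : Λ * K Y ≤ (P.valuation hm hs blk hd i y).val univ := by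
  rw [valuation_val_univ]
  have h1 : (0 : ℝ) ≤ ((y.2 : ℕ) : ℝ) := Nat.cast_nonneg _
  have := hK.pos Y
  nlinarith

theorem valuation_mem_between (hΛ : 2 * Λ * K Y ≤ K (Y + 1)) (hY : Y + 1 ≤ L) :
    P.valuation hm hs blk hd i y ∈ between m b K Y L := by
  have h1 : (1 : ℝ) ≤ Λ := by exact_mod_cast Fin.pos y.2
  have := hK.pos Y
  refine ⟨?_, ?_⟩
  · refine le_trans ?_ (P.le_valuation_val_univ hm hs blk hd hK i y)
    nlinarith
  · exact (P.valuation_val_univ_le hm hs blk hd hK i y).trans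
      (hΛ.trans (hK.strictMono.monotone hY))

end bounds

/-- The allocation that gives the special bundle of each group in `R` to the bidder `sel`. -/
def specialAllocation (R : Finset (Fin g)) (sel : Fin g → Fin n) : Allocation n m where
  bundle i := if blk i ∈ R ∧ sel (blk i) = i then P.Q (blk i) else ∅
  disjoint i j hij := by
    split_ifs with h1 h2
    · refine P.disjoint_Q _ _ fun h => hij ?_
      rw [← h1.2, ← h2.2, h]
    all_goals simp

open Classical in
/-- The number of groups in which somebody wants the special bundle is small if few bidders win. -/
theorem card_groups_le (hK : IsScale n b L ρ K) (hρ : 0 ≤ ρ)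
    (ω : Fin n → (Finset (Fin m) → Fin q) × Fin Λ) (o : Allocation n m)
    (happrox : ∀ A, welfare (fun i => P.valuation hm hs blk hd i (ω i)) A ≤
      ρ * welfare (fun i => P.valuation hm hs blk hd i (ω i)) o) (hΛ : 0 < Λ) (hn : 0 < n) :
    (#{u | ∃ i, blk i = u ∧ (ω i).1 (P.Q u) = 0} : ℝ) ≤
      2 * ρ * #{i | o.bundle i ∈ (P.family hm hs blk i (ω i).1).carrier} := by
  have hKpos : 0 < Λ * K Y := mul_pos (by exact_mod_cast hΛ) (hK.pos Y)
  set R : Finset (Fin g) := {u | ∃ i, blk i = u ∧ (ω i).1 (P.Q u) = 0} with hR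
  have hsel : ∀ u, ∃ i, u ∈ R → blk i = u ∧ (ω i).1 (P.Q u) = 0 := by
    intro u
    by_cases hu : u ∈ R
    · obtain ⟨i, hi⟩ := (mem_filter.1 hu).2
      exact ⟨i, fun _ => hi⟩
    · exact ⟨⟨0, hn⟩, fun h => absurd h hu⟩
  choose sel hsel using hsel
  have h1 : #R * (Λ * K Y) ≤ welfare (fun i => P.valuation hm hs blk hd i (ω i))
      (P.specialAllocation blk R sel) := by
    have hinj : Set.InjOn sel R := fun u hu u' hu' he => by
      rw [← (hsel u hu).1, ← (hsel u' hu').1, he]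
    rw [← card_image_of_injOn hinj, ← nsmul_eq_mul, ← sum_const, welfare]
    refine (sum_le_sum fun i hi => ?_).trans (sum_le_sum_of_subset_of_nonneg (subset_univ _)
      fun i _ _ => GeneralValuation.val_nonneg _ _)
    obtain ⟨u, hu, rfl⟩ := mem_image.1 hi
    obtain ⟨hb, hx⟩ := hsel u hu
    have hmem : P.Q u ∈ (P.family hm hs blk (sel u) (ω (sel u)).1).carrier :=
      Or.inr ⟨P.Q u, by rw [hb]; exact subset_union_right, P.card_Q u, hx, subset_rfl⟩
    simp only [specialAllocation, hb, hu, true_and, if_true]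
    have h2 := P.le_valuation_val_univ hm hs blk hd hK (sel u) (ω (sel u))
    rw [valuation_val_univ] at h2
    rw [valuation, UpFamily.val_of_mem _ _ hmem]
    exact h2
  -- The factor `2` in the conclusion comes from here: values range between `Λ * K Y` and `2 * Λ * K
  -- Y`.
  have h2 : welfare (fun i => P.valuation hm hs blk hd i (ω i)) o ≤
      #{i | o.bundle i ∈ (P.family hm hs blk i (ω i).1).carrier} * (2 * Λ * K Y) := by
    rw [← nsmul_eq_mul, ← sum_const, sum_filter, welfare]
    refine sum_le_sum fun i _ => ?_
    split_ifs with hi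
    · exact (GeneralValuation.val_le_univ _ _).trans (P.valuation_val_univ_le hm hs blk hd hK i _)
    · exact (UpFamily.val_of_notMem _ _ hi).le
  have h3 := h1.trans ((happrox _).trans (mul_le_mul_of_nonneg_left h2 hρ))
  refine le_of_mul_le_mul_right ?_ hKpos
  linarith

/-! ### Counting the winners for a fixed placement -/

section node

open Mechanism

variable {k : Fin n → ℕ} {next : (∀ i, Fin (k i + 1)) → Mechanism n m}
  (S : ∀ i, GeneralValuation m b → (node k next).Plan i)

/-- After the messages `z`, bidder `i` is certain to win something with one of the valuations
consistent with his message. -/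
def Guaranteed (z : ∀ i, Fin (k i + 1)) (i : Fin n) : Prop :=
  ∃ (x : Finset (Fin m) → Fin q) (c : ℝ) (hc : IsDescribable b c),
    (S i ((P.family hm hs blk i x).valuation c hc)).1 = z i ∧
    ∀ τ : ∀ j, (next z).Plan j, τ i = (S i ((P.family hm hs blk i x).valuation c hc)).2 z →
      ((next z).run τ).alloc.bundle i ∈ (P.family hm hs blk i x).carrier

-- A guarantee holds against all plans of the others, so all guaranteed bidders can use their
-- witnessing plans at once, and a single allocation then serves them all.
open Classical in
theorem card_guaranteed_le (z : ∀ i, Fin (k i + 1)) :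
    #{i | P.Guaranteed (q := q) hm hs blk S z i} ≤ s + g := by
  have hch : ∀ i, ∃ (x : Finset (Fin m) → Fin q) (p : (next z).Plan i),
      P.Guaranteed (q := q) hm hs blk S z i → ∀ τ : ∀ j, (next z).Plan j, τ i = p →
        ((next z).run τ).alloc.bundle i ∈ (P.family hm hs blk i x).carrier := by
    intro i
    by_cases hi : P.Guaranteed (q := q) hm hs blk S z i
    · obtain ⟨x, c, hc, -, h⟩ := hi
      exact ⟨x, _, fun _ => h⟩
    · exact ⟨fun _ => 0, default, fun h => absurd h hi⟩
  choose x p hp using hch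
  exact P.card_le hm hs blk ((next z).run p).alloc _ x fun i hi =>
    hp i (mem_filter.1 hi).2 p rfl

variable {S} (h : (node k next).Solves S (between m b K Y L) ρ)

open Classical in
include h in
/-- A bidder rarely wins at a price that is exactly his value. -/
theorem card_price_eq_le (hK : IsScale n b L ρ K) (hΛ : 2 * Λ * K Y ≤ K (Y + 1)) (hY : Y + 1 ≤ L)
    (hΛ0 : 0 < Λ) (ω : Fin n → (Finset (Fin m) → Fin q) × Fin Λ) (i : Fin n)
    (o : (Fin n → (Finset (Fin m) → Fin q) × Fin Λ) → Outcome n m)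
    (ho : ∀ ω, o ω = (node k next).run fun j => S j (P.valuation hm hs blk hd j (ω j))) :
    (#{y | (o (Function.update ω i y)).alloc.bundle i ∈ (P.family hm hs blk i y.1).carrier ∧
      (o (Function.update ω i y)).price i = (Λ + y.2) * K Y} : ℝ) ≤
      1 / Λ * Fintype.card ((Finset (Fin m) → Fin q) × Fin Λ) := by
  have hcard : (1 / Λ * Fintype.card ((Finset (Fin m) → Fin q) × Fin Λ) : ℝ) =
      #(univ : Finset (Finset (Fin m) → Fin q)) := by
    have : (Λ : ℝ) ≠ 0 := by exact_mod_cast hΛ0.ne'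
    rw [Fintype.card_prod, Fintype.card_fin, card_univ]
    push_cast
    field_simp
  rw [hcard, Nat.cast_le]
  -- If two values for the same `x` both won at a price equal to the value, the higher one would
  -- gain by reporting the lower. So each `x` admits at most one of the `Λ` values.
  have key : ∀ y y' : (Finset (Fin m) → Fin q) × Fin Λ, y.1 = y'.1 → y.2 < y'.2 →
      ((o (Function.update ω i y)).alloc.bundle i ∈ (P.family hm hs blk i y.1).carrier ∧
        (o (Function.update ω i y)).price i = (Λ + y.2) * K Y) →
      ((o (Function.update ω i y')).alloc.bundle i ∈ (P.family hm hs blk i y'.1).carrier ∧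
        (o (Function.update ω i y')).price i = (Λ + y'.2) * K Y) → False := by
    rintro ⟨x, j⟩ ⟨x', j'⟩ hx hj ⟨h1, h2⟩ ⟨h3, h4⟩
    obtain rfl : x = x' := hx
    simp only at h1 h2 h3 h4 hj
    have h5 := h.profit_update_le (i := i)
      (v := fun l => P.valuation hm hs blk hd l (Function.update ω i (x, j') l))
      (P.valuation_mem_between hm hs blk hd hK i _ hΛ hY) (P.valuation hm hs blk hd i (x, j))
    have e : ∀ l, Function.update
        (fun l => P.valuation hm hs blk hd l (Function.update ω i (x, j') l)) i
        (P.valuation hm hs blk hd i (x, j)) l =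
        P.valuation hm hs blk hd l (Function.update ω i (x, j) l) := by
      intro l
      by_cases hl : l = i
      · subst hl
        simp
      · simp [hl]
    simp only [e] at h5
    rw [← ho, ← ho, profit, profit, Function.update_self, h2, h4, valuation,
      UpFamily.val_of_mem _ _ h1, UpFamily.val_of_mem _ _ h3] at h5
    have h6 : ((j : ℕ) : ℝ) < (j' : ℕ) := by exact_mod_cast hj
    have := hK.pos Y
    simp only at h5
    nlinarith
  refine card_le_card_of_injOn Prod.fst (fun _ _ => mem_coe.2 (mem_univ _)) ?_
  intro y hy y' hy' he
  simp only [coe_filter, mem_univ, true_and, Set.mem_ofPred_eq] at hy hy'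
  rcases lt_trichotomy y.2 y'.2 with hlt | heq | hlt
  · exact (key y y' he hlt hy hy').elim
  · exact Prod.ext he heq
  · exact (key y' y he.symm hlt hy' hy).elim

open Classical in
include h in
theorem winner_cases (hK : IsScale n b L ρ K) (hρ : 0 ≤ ρ) (hYL : Y + 13 ≤ L)
    (hsplit : ∀ i, ∀ t ∈ between m b K Y L, t.val Finset.univ ≤ K (Y + 1) →
      (S i t).1 ≠ (S i ((UpFamily.grand m hm).valuation (K L) (hK.describable _ le_rfl))).1)
    (hΛ : 2 * Λ * K Y ≤ K (Y + 1)) (ω : Fin n → (Finset (Fin m) → Fin q) × Fin Λ) (i : Fin n)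
    (hwin : ((node k next).run fun j => S j (P.valuation hm hs blk hd j (ω j))).alloc.bundle i ∈
      (P.family hm hs blk i (ω i).1).carrier) :
    (∀ w ∈ between m b K Y L, ((node k next).run fun j => S j (Function.update
      (fun l => P.valuation hm hs blk hd l (ω l)) i w j)).alloc.bundle i ≠ ∅) ∨
    ((node k next).run fun j => S j (P.valuation hm hs blk hd j (ω j))).price i =
      (Λ + (ω i).2) * K Y ∨
    P.Guaranteed (q := q) hm hs blk S (fun j => (S j (P.valuation hm hs blk hd j (ω j))).1) i := by
  by_contra! hcon
  obtain ⟨hlose, hprice, hG⟩ := hcon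
  refine hG ?_
  have hY : Y + 1 ≤ L := by omega
  obtain ⟨c', hc', h1, -, h2⟩ := h.exists_guaranteed_win hK hρ hm hYL (hsplit i)
    (v := fun l => P.valuation hm hs blk hd l (ω l))
    (fun l => P.valuation_mem_between hm hs blk hd hK l _ hΛ hY)
    (fun l => (P.valuation_val_univ_le hm hs blk hd hK l _).trans hΛ)
    (F := P.family hm hs blk i (ω i).1) rfl hwin hprice hlose
  exact ⟨_, c', hc', h1, h2⟩

open Classical in
include h in
/-- The main counting inequality for a fixed placement. -/
theorem half_groups_le (hK : IsScale n b L ρ K) (hρ : 0 ≤ ρ) (hYL : Y + 13 ≤ L)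
    (hsplit : ∀ i, ∀ t ∈ between m b K Y L, t.val Finset.univ ≤ K (Y + 1) →
      (S i t).1 ≠ (S i ((UpFamily.grand m hm).valuation (K L) (hK.describable _ le_rfl))).1)
    (hΛ : 2 * Λ * K Y ≤ K (Y + 1)) (hΛ0 : 0 < Λ) (hn : 0 < n)
    (hblk : ∀ u, q ≤ #{i | blk i = u}) :
    (g : ℝ) / 2 ≤ 2 * ρ * (s + (m / q + n / Λ + 3 / q * (s + g) +
      ∑ i, (#{y : (Finset (Fin m) → Fin q) × Fin Λ |
        Biased (fun y => (S i (P.valuation hm hs blk hd i y)).1) (P.Q (blk i)) y} : ℝ) /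
          Fintype.card ((Finset (Fin m) → Fin q) × Fin Λ))) := by
  have hΛne : Nonempty (Fin Λ) := ⟨⟨0, hΛ0⟩⟩
  have hY : Y + 1 ≤ L := by omega
  set X := (Finset (Fin m) → Fin q) × Fin Λ with hX
  have hXpos : (0 : ℝ) < Fintype.card X := by exact_mod_cast Fintype.card_pos
  have hΩpos : (0 : ℝ) < Fintype.card (Fin n → X) := by exact_mod_cast Fintype.card_pos
  let v : (Fin n → X) → Fin n → GeneralValuation m b :=
    fun ω i => P.valuation hm hs blk hd i (ω i)
  let o : (Fin n → X) → Outcome n m := fun ω => (node k next).run fun j => S j (v ω j)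
  let msg : ∀ i, X → Fin (k i + 1) := fun i y => (S i (P.valuation hm hs blk hd i y)).1
  have hv : ∀ ω i, v ω i ∈ between m b K Y L := fun ω i =>
    P.valuation_mem_between hm hs blk hd hK i _ hΛ hY
  have hvupd : ∀ ω i y w, Function.update (v (Function.update ω i y)) i w =
      Function.update (v ω) i w := by
    intro ω i y w
    funext l
    by_cases hl : l = i
    · subst hl
      simp
    · simp [v, hl]
  let NE : (Fin n → X) → Fin n → Prop := fun ω i => ∀ w ∈ between m b K Y L,
    ((node k next).run fun j => S j (Function.update (v ω) i w j)).alloc.bundle i ≠ ∅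
  let Z : Fin n → X → Prop := fun i y => y.1 (P.Q (blk i)) = 0
  let Deg : (Fin n → X) → Fin n → Prop := fun ω i =>
    (o ω).alloc.bundle i ∈ (P.family hm hs blk i (ω i).1).carrier ∧
      (o ω).price i = (Λ + (ω i).2) * K Y
  let A : (Fin n → X) → Fin n → Prop := fun ω i =>
    P.Guaranteed (q := q) hm hs blk S (fun j => msg j (ω j)) i
  let Bi : Fin n → X → Prop := fun i y => Biased (msg i) (P.Q (blk i)) y
  let W : (Fin n → X) → Finset (Fin n) := fun ω =>
    {i | (o ω).alloc.bundle i ∈ (P.family hm hs blk i (ω i).1).carrier}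
  -- winners
  have hW : ∀ ω, (#(W ω) : ℝ) ≤ s + (#{i | NE ω i ∧ Z i (ω i)} + #{i | Deg ω i} +
      #{i | A ω i ∧ Z i (ω i) ∧ ¬Bi i (ω i)} + #{i | Bi i (ω i)}) := by
    intro ω
    have h1 : #{i ∈ W ω | ¬Disjoint ((o ω).alloc.bundle i) P.U} ≤ s :=
      ((o ω).alloc.card_meet_le _ _ fun i hi => (mem_filter.1 hi).2).trans P.card_U.le
    have h2 : ({i ∈ W ω | ¬¬Disjoint ((o ω).alloc.bundle i) P.U} : Finset (Fin n)) ⊆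
        ((univ.filter fun i => NE ω i ∧ Z i (ω i)) ∪ (univ.filter fun i => Deg ω i) ∪
          univ.filter fun i => A ω i ∧ Z i (ω i) ∧ ¬Bi i (ω i)) ∪
          univ.filter fun i => Bi i (ω i) := by
      intro i hi
      simp only [W, not_not, mem_filter, mem_univ, true_and] at hi
      have hz := (P.subset_of_disjoint hm hs blk hi.1 hi.2).2
      simp only [mem_union, mem_filter, mem_univ, true_and]
      rcases P.winner_cases hm hs blk hd h hK hρ hYL hsplit hΛ ω i hi.1 with h3 | h3 | h3
      · exact Or.inl (Or.inl (Or.inl ⟨h3, hz⟩))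
      · exact Or.inl (Or.inl (Or.inr ⟨hi.1, h3⟩))
      · by_cases hB : Bi i (ω i)
        · exact Or.inr hB
        · exact Or.inl (Or.inr ⟨h3, hz, hB⟩)
    have h3 := (card_le_card h2).trans ((card_union_le _ _).trans (Nat.add_le_add_right
      ((card_union_le _ _).trans (Nat.add_le_add_right (card_union_le _ _) _)) _))
    have h4 := card_filter_add_card_filter_not (s := W ω)
      fun i => ¬Disjoint ((o ω).alloc.bundle i) P.U
    rw [← h4]
    exact_mod_cast Nat.add_le_add h1 h3
  have swap : ∀ (R : (Fin n → X) → Fin n → Prop) [∀ ω i, Decidable (R ω i)],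
      ∑ ω, (#{i | R ω i} : ℝ) = ∑ i, (#{ω | R ω i} : ℝ) := by
    intro R _
    simp only [card_filter, Nat.cast_sum]
    exact sum_comm
  have hZ : ∀ i, (#{y | Z i y} : ℝ) ≤ 1 / q * Fintype.card X := fun i => card_zero_le _
  -- the four kinds of winners
  have hNE : ∑ ω, (#{i | NE ω i ∧ Z i (ω i)} : ℝ) ≤ 1 / q * (Fintype.card (Fin n → X) * m) := by
    rw [swap fun ω i => NE ω i ∧ Z i (ω i)]
    calc _ ≤ ∑ i, 1 / q * (#{ω | NE ω i} : ℝ) := by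
          refine sum_le_sum fun i _ => ?_
          refine Fintype.card_filter_le_of_update i _ _ _ fun ω => ?_
          have e : ∀ y, NE (Function.update ω i y) i ↔ NE ω i := by
            intro y
            simp only [NE, hvupd]
          simp only [e, Function.update_self]
          by_cases hne : NE ω i
          · simpa [hne] using hZ i
          · simp [hne]
      _ = 1 / q * ∑ ω, (#{i | NE ω i} : ℝ) := by rw [← mul_sum, swap fun ω i => NE ω i]
      _ ≤ 1 / q * ∑ _ω : Fin n → X, (m : ℝ) := by
          gcongr with ω
          have := (o ω).alloc.card_meet_le {i | NE ω i} univ (by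
            intro i hi hdis
            have h1 := (mem_filter.1 hi).2 (v ω i) (hv ω i)
            rw [Function.update_eq_self] at h1
            exact h1 (disjoint_self_iff_empty _ |>.1 (hdis.mono_right (subset_univ _))))
          simpa using this
      _ = _ := by simp
  have hDeg : ∑ ω, (#{i | Deg ω i} : ℝ) ≤ Fintype.card (Fin n → X) * (n / Λ) := by
    rw [swap fun ω i => Deg ω i]
    calc _ ≤ ∑ _i : Fin n, 1 / Λ * (#{_ω : Fin n → X | True} : ℝ) := by
          refine sum_le_sum fun i _ => ?_
          refine Fintype.card_filter_le_of_update i _ _ _ fun ω => ?_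
          have := P.card_price_eq_le hm hs blk hd h hK hΛ hY hΛ0 ω i o fun _ => rfl
          simp only [Deg, filter_true, card_univ, Function.update_self]
          exact this
      _ = _ := by
          simp
          ring
  -- `A` depends on the type of `i` only through his message, so `card_unbiased_le` applies with the
  -- other types fixed.
  have hA : ∑ ω, (#{i | A ω i ∧ Z i (ω i) ∧ ¬Bi i (ω i)} : ℝ) ≤
      3 / q * (Fintype.card (Fin n → X) * (s + g)) := by
    rw [swap fun ω i => A ω i ∧ Z i (ω i) ∧ ¬Bi i (ω i)]
    calc _ ≤ ∑ i, 3 / q * (#{ω | A ω i} : ℝ) := by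
          refine sum_le_sum fun i _ => ?_
          refine Fintype.card_filter_le_of_update i _ _ _ fun ω => ?_
          have e : ∀ y, A (Function.update ω i y) i ↔ P.Guaranteed (q := q) hm hs blk S
              (Function.update (fun j => msg j (ω j)) i (msg i y)) i := by
            intro y
            have : (fun j => msg j (Function.update ω i y j)) =
                Function.update (fun j => msg j (ω j)) i (msg i y) := by
              funext l
              by_cases hl : l = i
              · subst hl
                simp
              · simp [hl]
            simp only [A, this]
          simp only [e, Function.update_self]
          exact card_unbiased_le (msg i) (P.Q (blk i)) fun ζ => P.Guaranteed (q := q) hm hs blk S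
              (Function.update (fun j => msg j (ω j)) i ζ) i
      _ = 3 / q * ∑ ω, (#{i | A ω i} : ℝ) := by rw [← mul_sum, swap fun ω i => A ω i]
      _ ≤ 3 / q * ∑ _ω : Fin n → X, ((s + g : ℕ) : ℝ) := by
          gcongr with ω
          exact P.card_guaranteed_le hm hs blk S _
      _ = _ := by
          simp only [sum_const, nsmul_eq_mul, card_univ]
          push_cast
          ring
  have hBi : ∑ ω : Fin n → X, (#{i | Bi i (ω i)} : ℝ) ≤
      Fintype.card (Fin n → X) * ∑ i, (#{y | Bi i y} : ℝ) / Fintype.card X := by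
    rw [swap fun ω i => Bi i (ω i)]
    calc _ ≤ ∑ i, (#{y | Bi i y} : ℝ) / Fintype.card X * (#{_ω : Fin n → X | True} : ℝ) := by
          refine sum_le_sum fun i _ => ?_
          refine Fintype.card_filter_le_of_update i _ _ _ fun ω => ?_
          simp only [Function.update_self, filter_true, card_univ]
          rw [div_mul_cancel₀ _ hXpos.ne']
      _ = _ := by
          rw [← sum_mul, mul_comm]
          simp
  -- the groups
  have hR1 : ∀ ω, (#{u | ∃ i, blk i = u ∧ (ω i).1 (P.Q u) = 0} : ℝ) ≤ 2 * ρ * #(W ω) :=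
    fun ω => P.card_groups_le hm hs blk hd hK hρ ω (o ω).alloc
      (fun A => h.approx (v ω) (hv ω) A) hΛ0 hn
  have hR2 : (g : ℝ) / 2 * Fintype.card (Fin n → X) ≤
      ∑ ω : Fin n → X, (#{u | ∃ i, blk i = u ∧ (ω i).1 (P.Q u) = 0} : ℝ) := by
    have e : ∑ ω : Fin n → X, (#{u | ∃ i, blk i = u ∧ (ω i).1 (P.Q u) = 0} : ℝ) =
        ∑ u, (#{ω : Fin n → X | ∃ i, blk i = u ∧ (ω i).1 (P.Q u) = 0} : ℝ) := by
      simp only [card_filter, Nat.cast_sum]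
      exact sum_comm
    rw [e]
    have h1 : ∀ u, (1 : ℝ) / 2 * Fintype.card (Fin n → X) ≤
        #{ω : Fin n → X | ∃ i, blk i = u ∧ (ω i).1 (P.Q u) = 0} := by
      intro u
      have h2 : (#{ω : Fin n → X | ∀ i ∈ ({i | blk i = u} : Finset (Fin n)),
          ω i ∈ ({y | y.1 (P.Q u) ≠ 0} : Finset X)} : ℝ) ≤
            1 / 2 * Fintype.card (Fin n → X) := by
        convert card_forall_notMem_le (q := q) (X := X)
          (N := {y | y.1 (P.Q u) ≠ 0}) (card_nonzero_le _) (hblk u)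
      have h3 := card_filter_add_card_filter_not (s := (univ : Finset (Fin n → X)))
        fun ω => ∃ i, blk i = u ∧ (ω i).1 (P.Q u) = 0
      have h4 : #{ω : Fin n → X | ¬∃ i, blk i = u ∧ (ω i).1 (P.Q u) = 0} =
          #{ω : Fin n → X | ∀ i ∈ ({i | blk i = u} : Finset (Fin n)),
            ω i ∈ ({y | y.1 (P.Q u) ≠ 0} : Finset X)} := by
        congr 1
        ext ω
        simp
      rw [h4, card_univ] at h3
      have h5 : (#{ω : Fin n → X | ∃ i, blk i = u ∧ (ω i).1 (P.Q u) = 0} : ℝ) +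
          #{ω : Fin n → X | ∀ i ∈ ({i | blk i = u} : Finset (Fin n)),
            ω i ∈ ({y | y.1 (P.Q u) ≠ 0} : Finset X)} = Fintype.card (Fin n → X) := by
        exact_mod_cast h3
      linarith
    calc (g : ℝ) / 2 * Fintype.card (Fin n → X)
        = ∑ _u : Fin g, (1 : ℝ) / 2 * Fintype.card (Fin n → X) := by
          simp
          ring
      _ ≤ _ := sum_le_sum fun u _ => h1 u
  have hsumW : ∑ ω, (#(W ω) : ℝ) ≤ Fintype.card (Fin n → X) * (s + (m / q + n / Λ +
      3 / q * (s + g) + ∑ i, (#{y | Bi i y} : ℝ) / Fintype.card X)) := by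
    refine (sum_le_sum fun ω _ => hW ω).trans ?_
    simp only [sum_add_distrib]
    have e : ∑ _ω : Fin n → X, (s : ℝ) = Fintype.card (Fin n → X) * s := by simp
    rw [e]
    have e2 : (1 / q * (Fintype.card (Fin n → X) * m) : ℝ) =
      Fintype.card (Fin n → X) * (m / q) := by ring
    rw [e2] at hNE
    linarith
  have hR3 := hR2.trans (sum_le_sum fun ω _ => hR1 ω)
  rw [← mul_sum] at hR3
  have hR4 := hR3.trans (mul_le_mul_of_nonneg_left hsumW (by positivity))
  refine le_of_mul_le_mul_right ?_ hΩpos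
  linarith

end node

end Placement

/-! ### Choosing the placement -/

namespace Placement

variable {m g s : ℕ}

/-- Consecutive intervals of items. -/
def intervals (h : (g + 1) * s ≤ m) : Placement m g s :=
  let I : ∀ a, a ≤ g → Finset (Fin m) := fun a ha =>
    (Ico (a * s) ((a + 1) * s)).attachFin fun x hx =>
      (mem_Ico.1 hx).2.trans_le ((Nat.mul_le_mul_right s (by omega)).trans h)
  have hc : ∀ a ha, #(I a ha) = s := fun a ha => by
    simp only [I, card_attachFin, Nat.card_Ico, add_mul, one_mul, Nat.add_sub_cancel_left]
  have hd : ∀ a ha a' ha', a < a' → Disjoint (I a ha) (I a' ha') := fun a ha a' ha' haa => by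
    rw [disjoint_left]
    intro x hx hx'
    simp only [I, mem_attachFin, mem_Ico] at hx hx'
    have : (a + 1) * s ≤ a' * s := Nat.mul_le_mul_right s haa
    omega
  { U := I 0 (Nat.zero_le _)
    Q := fun u => I (u + 1) u.2
    card_U := hc 0 (Nat.zero_le _)
    card_Q := fun u => hc (u + 1) u.2
    disjoint_U := fun u => hd 0 (Nat.zero_le _) (u + 1) u.2 (Nat.succ_pos _)
    disjoint_Q := fun u u' huu => by
      rcases lt_or_gt_of_ne huu with h1 | h1
      · exact hd (u + 1) u.2 (u' + 1) u'.2 (Nat.succ_lt_succ h1)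
      · exact (hd (u' + 1) u'.2 (u + 1) u.2 (Nat.succ_lt_succ h1)).symm }

/-- The image of a placement under a permutation of the items. -/
def map (P : Placement m g s) (σ : Equiv.Perm (Fin m)) : Placement m g s where
  U := P.U.map σ.toEmbedding
  Q u := (P.Q u).map σ.toEmbedding
  card_U := by rw [card_map, P.card_U]
  card_Q u := by rw [card_map, P.card_Q]
  disjoint_U u := (disjoint_map _).2 (P.disjoint_U u)
  disjoint_Q u u' h := (disjoint_map _).2 (P.disjoint_Q u u' h)

open Classical in
/-- For a suitable permutation of the items the messages carry little information about the
special bundles. -/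
theorem exists_perm_sum_biased_le {n b q Λ Y : ℕ} [NeZero q] {K : ℕ → ℝ} (P : Placement m g s)
    (hm : 0 < m) (hs : 0 < s) (blk : Fin n → Fin g) (hΛ0 : 0 < Λ)
    (hd : ∀ j : Fin Λ, IsDescribable b ((Λ + j) * K Y)) (k : Fin n → ℕ)
    (f : ∀ i, GeneralValuation m b → Fin (k i + 1)) :
    ∃ σ : Equiv.Perm (Fin m),
      ∑ i, (#{y : (Finset (Fin m) → Fin q) × Fin Λ |
        Biased (fun y => f i ((P.map σ).valuation hm hs blk hd i y)) ((P.map σ).Q (blk i)) y} : ℝ) /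
          Fintype.card ((Finset (Fin m) → Fin q) × Fin Λ) ≤
      q * (∑ i, Nat.clog 2 (k i + 1) : ℕ) / (2 * s).choose s := by
  have hΛne : Nonempty (Fin Λ) := ⟨⟨0, hΛ0⟩⟩
  set N : ℝ := ((Fintype.card ((Finset (Fin m) → Fin q) × Fin Λ) : ℕ) : ℝ) with hN
  have hNpos : 0 < N := by
    rw [hN]
    exact_mod_cast Fintype.card_pos
  have hC : (0 : ℝ) < (2 * s).choose s := by
    exact_mod_cast Nat.choose_pos (by omega)
  -- The family, and with it the message, depends on the placement only through `G`. So `Q'` can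
  -- vary inside a fixed `G`, and the entropy bound controls the sum over all candidates.
  let φ : Fin n → Finset (Fin m) → Finset (Fin m) → ℝ := fun i G Q' =>
    (#{y : (Finset (Fin m) → Fin q) × Fin Λ | Biased
      (fun y : (Finset (Fin m) → Fin q) × Fin Λ => f i ((UpFamily.generated hm hs G y.1).valuation ((Λ + y.2) * K Y) (hd y.2))) Q' y} : ℝ) / N
  have h1 : ∀ i G, ∑ Q' ∈ powersetCard s G, φ i G Q' ≤ q * Real.log (k i + 1 : ℕ) := by
    intro i G
    simp only [φ]
    rw [← sum_div, div_le_iff₀ hNpos, mul_comm]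
    exact sum_card_biased_le _ _
  have h2 : ∀ i, Real.log (k i + 1 : ℕ) ≤ (Nat.clog 2 (k i + 1) : ℝ) := by
    intro i
    have e1 : ((k i + 1 : ℕ) : ℝ) ≤ (2 : ℝ) ^ Nat.clog 2 (k i + 1) := by
      exact_mod_cast Nat.le_pow_clog (by norm_num) _
    calc Real.log (k i + 1 : ℕ) ≤ Real.log ((2 : ℝ) ^ Nat.clog 2 (k i + 1)) :=
          Real.log_le_log (by positivity) e1
      _ = Nat.clog 2 (k i + 1) * Real.log 2 := Real.log_pow _ _
      _ ≤ Nat.clog 2 (k i + 1) * 1 := by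
          gcongr
          have := Real.log_two_lt_d9
          linarith
      _ = _ := mul_one _
  have h3 : ∀ i, ((2 * s).choose s : ℝ) * ∑ σ : Equiv.Perm (Fin m),
      φ i ((P.map σ).U ∪ (P.map σ).Q (blk i)) ((P.map σ).Q (blk i)) ≤
        m.factorial * (q * Nat.clog 2 (k i + 1)) := by
    intro i
    have e := choose_mul_sum_perm_le (G := P.U ∪ P.Q (blk i)) (Q := P.Q (blk i))
      subset_union_right (φ i) (q * Real.log (k i + 1 : ℕ)) (by
        intro G
        have hcard : #(P.Q (blk i)) = s := P.card_Q _
        rw [hcard]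
        exact h1 i G)
    have hcU : #(P.U ∪ P.Q (blk i)) = 2 * s := by
      rw [card_union_of_disjoint (P.disjoint_U _)]
      have e1 : #P.U = s := P.card_U
      have e2 : #(P.Q (blk i)) = s := P.card_Q _
      omega
    have hcQ : #(P.Q (blk i)) = s := P.card_Q _
    rw [hcU, hcQ, Fintype.card_fin] at e
    simp only [map_union] at e
    refine e.trans ?_
    gcongr
    exact h2 i
  have h4 : ∑ σ : Equiv.Perm (Fin m),
      ∑ i, φ i ((P.map σ).U ∪ (P.map σ).Q (blk i)) ((P.map σ).Q (blk i)) ≤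
      ∑ _σ : Equiv.Perm (Fin m),
        (q * (∑ i, Nat.clog 2 (k i + 1) : ℕ) / (2 * s).choose s : ℝ) := by
    rw [sum_comm, sum_const, card_univ, Fintype.card_perm, Fintype.card_fin, nsmul_eq_mul,
      mul_div_assoc', le_div_iff₀ hC, mul_comm, mul_sum]
    refine (sum_le_sum fun i _ => h3 i).trans (le_of_eq ?_)
    push_cast
    rw [← mul_sum, ← mul_sum]
  obtain ⟨σ, -, hσ⟩ := exists_le_of_sum_le (univ_nonempty) h4
  exact ⟨σ, hσ⟩

end Placement

/-! ### The bound for a mechanism, in terms of the parameters -/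

namespace Mechanism

variable {n m b : ℕ} {M : Mechanism n m} {S : ∀ i, M.Strategy b i} {ρ : ℝ}

/-- The mechanism's own allocation, once its welfare is known to be positive, is compared with
itself. -/
theorem Approximates.one_le (h : M.Approximates b S ρ) (hm : 0 < m) (hn : 0 < n)
    (hb : 0 < b) : 1 ≤ ρ := by
  have h1 : IsDescribable b 1 := ⟨1, 0, Nat.one_lt_two_pow hb.ne', by simp, by simp⟩
  let v : Fin n → GeneralValuation m b := fun _ => (UpFamily.grand m hm).valuation 1 h1
  set A := (M.run fun i => S i (v i)).alloc
  have h2 := h v (Allocation.all m ⟨0, hn⟩)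
  rw [welfare_all, UpFamily.val_univ] at h2
  have h3 : 0 ≤ welfare v A := sum_nonneg fun i _ => GeneralValuation.val_nonneg _ _
  have h4 : 0 < welfare v A := by
    refine lt_of_le_of_ne h3 fun h0 => ?_
    change _ ≤ ρ * welfare v A at h2
    rw [← h0] at h2
    linarith
  have h5 := h v A
  change _ ≤ ρ * welfare v A at h5
  by_contra! hlt
  nlinarith

theorem Approximates.cc_ne_zero (h : M.Approximates b S ρ) (hm : 0 < m) (hn : 2 ≤ n)
    (hb : 0 < b) : M.cc ≠ 0 := by
  intro hcc
  have h1 : IsDescribable b 1 := ⟨1, 0, Nat.one_lt_two_pow hb.ne', by simp, by simp⟩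
  have key : ∀ (τ : ∀ j, M.Plan j) j, (M.run τ).alloc.bundle j = univ := by
    intro τ j
    let v : Fin n → GeneralValuation m b := fun i =>
      if i = j then (UpFamily.grand m hm).valuation 1 h1
      else (UpFamily.grand m hm).valuation 0 (isDescribable_zero b)
    have h2 := h v (Allocation.all m j)
    rw [welfare_all, run_eq_of_cc_eq_zero hcc _ τ] at h2
    have hvj : v j = (UpFamily.grand m hm).valuation 1 h1 := if_pos rfl
    rw [hvj, UpFamily.val_univ] at h2
    by_contra hne
    have h3 : welfare v (M.run τ).alloc = 0 := by
      refine sum_eq_zero fun i _ => ?_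
      by_cases hij : i = j
      · subst hij
        rw [hvj]
        exact UpFamily.val_of_notMem _ _ hne
      · have : v i = (UpFamily.grand m hm).valuation 0 (isDescribable_zero b) := if_neg hij
        rw [this]
        refine le_antisymm ?_ (GeneralValuation.val_nonneg _ _)
        exact (GeneralValuation.val_le_univ _ _).trans (UpFamily.val_univ _ _).le
    rw [h3] at h2
    linarith
  have τ : ∀ j, M.Plan j := fun j => default
  have h4 := (M.run τ).alloc.disjoint ⟨0, by omega⟩ ⟨1, by omega⟩ (by simp)
  rw [key, key, disjoint_self_iff_empty] at h4
  have : (⟨0, hm⟩ : Fin m) ∈ (univ : Finset (Fin m)) := mem_univ _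
  rw [h4] at this
  simp at this

/-- The lower bound on the communication complexity in terms of the parameters of the hard
instance: `g` groups of at least `q` bidders and bundles of size `s`. -/
theorem half_groups_le_of_approximates {g s q : ℕ} [NeZero q] (hm : 0 < m) (hn : 3 ≤ n)
    (hs : 0 < s) (hgs : (g + 1) * s ≤ m) (blk : Fin n → Fin g)
    (hblk : ∀ u, q ≤ #{i | blk i = u}) (hb : 2 * m + 1 ≤ b)
    (hnorm : M.Normalized) (hnnt : M.NoNegativeTransfers) (hdom : ∀ i, M.IsDominant b i (S i))
    (happ : M.Approximates b S ρ) (hρm : ρ ≤ m) (hnm : n ≤ 2 ^ m) (hcc : M.cc ≤ 2 ^ m)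
    (hm50 : 100 * m ≤ 2 ^ m) :
    (g : ℝ) / 2 ≤ 2 * ρ * (s + (m / q + n / (2 : ℝ) ^ m + 3 / q * (s + g) +
      q * M.cc / (2 * s).choose s)) := by
  have hρ : 0 ≤ ρ := zero_le_one.trans (happ.one_le hm (by omega) (by omega))
  set L := 12 * (M.cc + 1) + 1 with hL
  -- The ratio `2 ^ (4 * m)` exceeds `ρ * n ≤ 2 ^ (2 * m)` and leaves room for the `2 ^ m` values
  -- between `Λ * K Y` and `2 * Λ * K Y`, where `Λ = 2 ^ m`.
  let K : ℕ → ℝ := fun l => (2 : ℝ) ^ (4 * m * l)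
  -- As `L ≤ 25 * 2 ^ m`, the largest exponent is at most `100 * m * 2 ^ m ≤ 2 ^ (2 * m)`; this is
  -- where `b ≥ 2 * m + 1` is needed.
  have h2b : 4 * m * L < 2 ^ b := by
    have e1 : 2 ^ (2 * m + 1) ≤ 2 ^ b := Nat.pow_le_pow_right (by norm_num) hb
    have e2 : 2 ^ (2 * m + 1) = 2 * (2 ^ m * 2 ^ m) := by ring
    have e3 : L ≤ 12 * 2 ^ m + 13 := by omega
    have e4 : 4 * m * L ≤ 4 * m * (25 * 2 ^ m) := by
      refine Nat.mul_le_mul_left _ ?_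
      have := Nat.one_le_two_pow (n := m)
      omega
    have e5 : 4 * m * (25 * 2 ^ m) ≤ 2 ^ m * 2 ^ m := by
      calc 4 * m * (25 * 2 ^ m) = (100 * m) * 2 ^ m := by ring
        _ ≤ _ := Nat.mul_le_mul_right _ hm50
    have e6 : 0 < 2 ^ m * 2 ^ m := by positivity
    omega
  have hdesc : ∀ l ≤ L, ∀ a : ℕ, a < 2 ^ b → IsDescribable b (a * K l) := by
    intro l hl a ha
    refine ⟨a, (4 * m * l : ℕ), ha, ?_, ?_⟩
    · have : 4 * m * l ≤ 4 * m * L := Nat.mul_le_mul_left _ hl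
      rw [abs_of_nonneg (by positivity)]
      exact_mod_cast this.trans_lt h2b
    · rw [zpow_natCast]
  have hK : IsScale n b L ρ K := by
    refine ⟨fun l => by positivity, ?_, fun l => ?_, fun l hl => ?_⟩
    · intro l l' hll
      exact pow_lt_pow_right₀ (by norm_num) (Nat.mul_lt_mul_of_pos_left hll (by omega))
    · have e1 : K (l + 1) = (2 : ℝ) ^ (4 * m) * K l := by
        simp only [K]
        rw [← pow_add]
        ring_nf
      have e2 : ρ ≤ (2 : ℝ) ^ m := hρm.trans (by exact_mod_cast Nat.lt_two_pow_self.le)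
      have e3 : (n : ℝ) ≤ (2 : ℝ) ^ m := by exact_mod_cast hnm
      have e4 : ρ * n ≤ (2 : ℝ) ^ (2 * m) := by
        rw [two_mul, pow_add]
        exact mul_le_mul e2 e3 (by positivity) (by positivity)
      have e5 : (2 : ℝ) ^ (2 * m) < (2 : ℝ) ^ (4 * m) :=
        pow_lt_pow_right₀ (by norm_num) (by omega)
      have e6 : 0 < K l := by positivity
      rw [e1, ← mul_assoc]
      exact mul_lt_mul_of_pos_right (e4.trans_lt e5) e6
    · have := hdesc l hl 1 (Nat.one_lt_two_pow (by omega))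
      simpa using this
  have hsolves : M.Solves S (between m b K 0 L) ρ :=
    ⟨fun i v _ => (hdom i).dominantPlan v, fun v _ A => happ v A, hnorm, hnnt⟩
  -- A gap of `12` gives exactly `Y + 13 ≤ L`, as `message_const_of_unsplit` requires.
  obtain ⟨k, next, S', Y, hcc', hYL, hS', i₀, w, hw, w', hw', hne⟩ :=
    exists_splitting_node (by omega) hm hρ hK 12 M S 0 (by omega) hsolves
  have hsub : between m b K (Y + 12) L ⊆ between m b K (Y + 10) L := fun v hv =>
    ⟨(hK.strictMono.monotone (by omega)).trans hv.1, hv.2⟩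
  have hsplit : ∀ i, ∀ t ∈ between m b K Y L, t.val univ ≤ K (Y + 1) →
      (S' i t).1 ≠ (S' i ((UpFamily.grand m hm).valuation (K L) (hK.describable _ le_rfl))).1 := by
    intro i t ht hta hmsg
    refine hne ?_
    rw [hS'.message_const_of_unsplit hK hρ hm hn (by omega) ht hta hmsg i₀ (hsub hw),
      hS'.message_const_of_unsplit hK hρ hm hn (by omega) ht hta hmsg i₀ (hsub hw')]
  have hd : ∀ j : Fin (2 ^ m), IsDescribable b (((2 ^ m : ℕ) + (j : ℕ)) * K Y) := by
    intro j
    have e : 2 ^ m + (j : ℕ) < 2 ^ b := by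
      have h1 := j.2
      have h2 : 2 ^ (m + 1) ≤ 2 ^ b := Nat.pow_le_pow_right (by norm_num) (by omega)
      rw [pow_succ] at h2
      omega
    have := hdesc Y (by omega) _ e
    rwa [Nat.cast_add] at this
  have hΛ : 2 * (2 ^ m : ℕ) * K Y ≤ K (Y + 1) := by
    have e1 : K (Y + 1) = (2 : ℝ) ^ (4 * m) * K Y := by
      simp only [K]
      rw [← pow_add]
      ring_nf
    have e6 : 0 < K Y := by positivity
    rw [e1]
    refine mul_le_mul_of_nonneg_right ?_ e6.le
    push_cast
    rw [← pow_succ']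
    exact pow_le_pow_right₀ (by norm_num) (by omega)
  have hΛ0 : 0 < 2 ^ m := by positivity
  -- The vertex was found without reference to the placement, so its message functions are fixed
  -- while the items are permuted.
  obtain ⟨σ, hσ⟩ := (Placement.intervals hgs).exists_perm_sum_biased_le (q := q) hm hs blk hΛ0 hd k
    fun i v => (S' i v).1
  have hmain := ((Placement.intervals hgs).map σ).half_groups_le (q := q) hm hs blk hd hS' hK hρ
    (by omega) hsplit hΛ hΛ0 (by omega) hblk
  refine hmain.trans ?_
  have hsum : (∑ i, Nat.clog 2 (k i + 1)) ≤ M.cc := by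
    have := cc_next_le (next := next) fun _ => 0
    omega
  have h5 := hσ.trans (show _ ≤ (q * M.cc / (2 * s).choose s : ℝ) by
    have : ((∑ i, Nat.clog 2 (k i + 1) : ℕ) : ℝ) ≤ M.cc := by exact_mod_cast hsum
    gcongr)
  push_cast at h5 ⊢
  gcongr

end Mechanism

end

/-! ### Choice of the parameters and conclusion -/

open Filter in
/-- The numerical conditions on the number of items. -/
theorem eventually_large_items {ε : ℝ} (a : ℝ) (hε : 0 < ε) (hε' : ε < 1 / 4) :
    ∀ᶠ m : ℕ in atTop, 20 ≤ (m : ℝ) ^ ε ∧ 2 / a ≤ (m : ℝ) ^ ε ∧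
      100 * m ≤ 2 ^ m ∧ (m : ℝ) ^ (ε ^ 2 / 2) ≤ (m : ℝ) ^ ε / 2 ∧
      8 * (m : ℝ) ≤ 2 ^ ((m : ℝ) ^ ε / 2) ∧ 20 ≤ (m : ℝ) ^ (1 - 2 * ε) := by
  have h1 : Tendsto (fun m : ℕ => (m : ℝ) ^ ε) atTop atTop :=
    (tendsto_rpow_atTop hε).comp tendsto_natCast_atTop_atTop
  have h2 : Tendsto (fun m : ℕ => (m : ℝ) ^ (1 - 2 * ε)) atTop atTop :=
    (tendsto_rpow_atTop (by linarith)).comp tendsto_natCast_atTop_atTop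
  have h3 : Tendsto (fun m : ℕ => (m : ℝ) ^ (ε - ε ^ 2 / 2)) atTop atTop :=
    (tendsto_rpow_atTop (by nlinarith)).comp tendsto_natCast_atTop_atTop
  have h4 : ∀ᶠ m : ℕ in atTop, 100 * m ≤ 2 ^ m := by
    filter_upwards [eventually_ge_atTop 10] with m hm
    induction m, hm using Nat.le_induction with
    | base => norm_num
    | succ k hk ih =>
      rw [pow_succ]
      omega
  have h5 : ∀ᶠ m : ℕ in atTop, 8 * (m : ℝ) ≤ 2 ^ ((m : ℝ) ^ ε / 2) := by
    have e1 : Tendsto (fun y : ℝ => Real.exp (Real.log 2 / 2 * y) / y ^ (1 / ε)) atTop atTop :=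
      tendsto_exp_mul_div_rpow_atTop _ _ (by have := Real.log_pos one_lt_two; positivity)
    filter_upwards [(e1.comp h1).eventually_ge_atTop 8, eventually_gt_atTop 0] with m hm hm0
    have hm0' : (0 : ℝ) < m := by exact_mod_cast hm0
    simp only [Function.comp_apply] at hm
    rw [← Real.rpow_mul hm0'.le, mul_one_div_cancel hε.ne', Real.rpow_one, le_div_iff₀ hm0'] at hm
    rwa [Real.rpow_def_of_pos two_pos, mul_div_assoc', mul_div_right_comm]
  filter_upwards [h1.eventually_ge_atTop 20, h1.eventually_ge_atTop (2 / a), h4,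
    h3.eventually_ge_atTop 2, h5, h2.eventually_ge_atTop 20, eventually_gt_atTop 0] with
    m a1 a2 a3 a4 a5 a6 hm0
  have hm0' : (0 : ℝ) < m := by exact_mod_cast hm0
  refine ⟨a1, a2, a3, ?_, a5, a6⟩
  rw [Real.rpow_sub hm0', le_div_iff₀ (by positivity)] at a4
  linarith

theorem Fin.exists_partition {n g q : ℕ} (hg : 0 < g) (h : q * g ≤ n) :
    ∃ blk : Fin n → Fin g, ∀ u, q ≤ Finset.card {i | blk i = u} := by
  refine ⟨fun i => ⟨i % g, Nat.mod_lt _ hg⟩, fun u => ?_⟩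
  have hlt : ∀ j : Fin q, j * g + u < n := fun j => by
    have : (j + 1) * g ≤ q * g := Nat.mul_le_mul_right g j.2
    rw [add_mul, one_mul] at this
    have := u.2
    omega
  have hinj : Function.Injective fun j : Fin q => (⟨j * g + u, hlt j⟩ : Fin n) := fun j j' hj => by
    have := Fin.mk.inj hj
    exact Fin.ext (Nat.eq_of_mul_eq_mul_right hg (by omega))
  calc q = Finset.card (Finset.univ.map ⟨_, hinj⟩) := by simp
    _ ≤ _ := Finset.card_le_card fun i hi => by
      obtain ⟨j, -, rfl⟩ := Finset.mem_map.1 hi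
      refine Finset.mem_filter.2 ⟨Finset.mem_univ _, Fin.ext ?_⟩
      simp [Nat.mod_eq_of_lt u.2]

theorem two_pow_le_choose_two_mul (s : ℕ) : 2 ^ s ≤ (2 * s).choose s := by
  induction s with
  | zero => simp
  | succ k ih =>
    have h1 := Nat.succ_mul_centralBinom_succ k
    simp only [Nat.centralBinom_eq_two_mul_choose] at h1
    have h2 : (k + 1) * (2 * (2 * k).choose k) ≤ (k + 1) * (2 * (k + 1)).choose (k + 1) := by
      rw [h1]
      nlinarith
    have := Nat.le_of_mul_le_mul_left h2 (Nat.succ_pos k)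
    rw [pow_succ]
    omega

/-- A choice of the number `g` of groups, the size `q` of a group and the size `s` of a bundle. -/
theorem exists_parameters {m : ℕ} {n a X Z : ℝ} (hX : 20 ≤ X) (hZ : 20 ≤ Z) (hm : m = X * X * Z)
    (ha : 0 < a) (hXa : 2 / a ≤ X) (hn : a * (m * (X * Z)) ≤ n) (hm8 : 8 * (m : ℝ) ≤ 2 ^ (X / 2)) :
    ∃ g s q : ℕ, 0 < g ∧ 0 < s ∧ 3 ≤ q ∧ q * g ≤ n ∧ (g + 1) * s ≤ m ∧ X * Z ≤ 4 * g ∧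
      s ≤ X ∧ (m : ℝ) / q ≤ X ∧ 3 / (q : ℝ) * (s + g) ≤ X ∧
      ∀ C : ℝ, C ≤ 2 ^ (X / 2) → q * C / (2 * s).choose s ≤ 1 := by
  have hX0 : 0 < X := by linarith
  have hXZ : 400 ≤ X * Z := by nlinarith
  have hXXZ : 20 * (X * Z) ≤ m := by
    rw [hm, mul_assoc]
    exact mul_le_mul_of_nonneg_right hX (by linarith)
  have h20 : 20 * X ≤ X * Z := by
    rw [mul_comm]
    exact mul_le_mul_of_nonneg_left hZ hX0.le
  -- The choice is `s = ⌊X⌋`, `g = ⌊X * Z / 2⌋`, `q = ⌈X * Z⌉`, to be used with `X = m ^ ε` and `Z =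
  -- m ^ (1 - 2 * ε)`.
  have hs : (⌊X⌋₊ : ℝ) ≤ X := Nat.floor_le hX0.le
  have hs' : X < ⌊X⌋₊ + 1 := Nat.lt_floor_add_one X
  have hg : (⌊X * Z / 2⌋₊ : ℝ) ≤ X * Z / 2 := Nat.floor_le (by linarith)
  have hg' : X * Z / 2 < ⌊X * Z / 2⌋₊ + 1 := Nat.lt_floor_add_one _
  have hq : X * Z ≤ ⌈X * Z⌉₊ := Nat.le_ceil _
  have hq' : (⌈X * Z⌉₊ : ℝ) < X * Z + 1 := Nat.ceil_lt_add_one (by linarith)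
  generalize ⌊X⌋₊ = s at *
  generalize ⌈X * Z⌉₊ = q at *
  generalize ⌊X * Z / 2⌋₊ = g at *
  have hq0 : (0 : ℝ) < q := by linarith
  refine ⟨g, s, q, ?_, ?_, ?_, ?_, ?_, by linarith, hs, ?_, ?_, fun C hC => ?_⟩
  · have : (0 : ℝ) < g := by linarith
    exact_mod_cast this
  · have : (0 : ℝ) < s := by linarith
    exact_mod_cast this
  · have : (3 : ℝ) ≤ q := by linarith
    exact_mod_cast this
  · have e1 : (q : ℝ) * g ≤ (2 * (X * Z)) * (X * Z / 2) := by gcongr; linarith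
    have e2 : 2 ≤ X * a := by rwa [div_le_iff₀ ha] at hXa
    have e3 : X * Z ≤ a * m := by
      rw [hm, show a * (X * X * Z) = (X * a) * (X * Z) by ring]
      exact le_mul_of_one_le_left (by linarith) (by linarith)
    have e4 : X * Z * (X * Z) ≤ a * m * (X * Z) := mul_le_mul_of_nonneg_right e3 (by linarith)
    linarith
  · have : ((g : ℝ) + 1) * s ≤ m := by
      calc ((g : ℝ) + 1) * s ≤ (X * Z) * X := by gcongr; linarith
        _ = m := by rw [hm]; ring
    exact_mod_cast this
  · rw [div_le_iff₀ hq0, hm, mul_assoc]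
    gcongr
  · rw [div_mul_eq_mul_div, div_le_iff₀ hq0]
    have : 20 * (X * Z) ≤ X * q := mul_le_mul hX hq (by linarith) hX0.le
    linarith
  · have c1 : (2 : ℝ) ^ s ≤ (2 * s).choose s := by exact_mod_cast two_pow_le_choose_two_mul s
    have c2 : (2 : ℝ) ^ X ≤ 2 * 2 ^ s := by
      rw [← pow_succ', ← Real.rpow_natCast]
      refine Real.rpow_le_rpow_of_exponent_le one_le_two ?_
      push_cast
      exact hs'.le
    have c3 : (2 : ℝ) ^ X = 2 ^ (X / 2) * 2 ^ (X / 2) := by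
      rw [← Real.rpow_add two_pos, add_halves]
    have c5 : (0 : ℝ) < 2 ^ (X / 2) := by positivity
    have c6 : (q : ℝ) * C ≤ 4 * m * 2 ^ (X / 2) :=
      (mul_le_mul_of_nonneg_left hC hq0.le).trans (mul_le_mul_of_nonneg_right (by linarith) c5.le)
    have c7 := mul_le_mul_of_nonneg_right hm8 c5.le
    rw [div_le_one (by exact_mod_cast Nat.choose_pos (by omega))]
    linarith

namespace Mechanism

variable {n m b : ℕ} {M : Mechanism n m} {S : ∀ i, M.Strategy b i} {ρ : ℝ}

theorem two_rpow_div_le_cc {ε a : ℝ} (hε : 0 < ε) (hε' : ε < 1 / 4) (ha : 0 < a)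
    (hX20 : 20 ≤ (m : ℝ) ^ ε) (hXa : 2 / a ≤ (m : ℝ) ^ ε) (hm100 : 100 * m ≤ 2 ^ m)
    (hexp : (m : ℝ) ^ (ε ^ 2 / 2) ≤ (m : ℝ) ^ ε / 2) (hm8 : 8 * (m : ℝ) ≤ 2 ^ ((m : ℝ) ^ ε / 2))
    (hZ20 : 20 ≤ (m : ℝ) ^ (1 - 2 * ε)) (hn : a * (m : ℝ) ^ (2 - ε) ≤ n) (hb : 2 * m + 1 ≤ b)
    (hnorm : M.Normalized) (hnnt : M.NoNegativeTransfers) (hdom : ∀ i, M.IsDominant b i (S i))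
    (hρ : ρ < (m : ℝ) ^ (1 - 4 * ε)) (happ : M.Approximates b S ρ) :
    (2 : ℝ) ^ ((m : ℝ) ^ (ε ^ 2 / 2)) / n ≤ M.cc := by
  have hm : 0 < m := by
    rcases Nat.eq_zero_or_pos m with rfl | h
    · rw [Nat.cast_zero, Real.zero_rpow hε.ne'] at hX20
      linarith
    · exact h
  have hm0 : (0 : ℝ) < m := by exact_mod_cast hm
  have hm1 : (1 : ℝ) ≤ m := by exact_mod_cast hm
  have hρm : ρ ≤ m := hρ.le.trans (by
    simpa using Real.rpow_le_rpow_of_exponent_le hm1 (show 1 - 4 * ε ≤ 1 by linarith))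
  have hmXXZ : (m : ℝ) = (m : ℝ) ^ ε * (m : ℝ) ^ ε * (m : ℝ) ^ (1 - 2 * ε) := by
    rw [← Real.rpow_add hm0, ← Real.rpow_add hm0]
    ring_nf
    rw [Real.rpow_one]
  have hW : (m : ℝ) ^ (1 - 4 * ε) * ((m : ℝ) ^ ε * (m : ℝ) ^ ε) = (m : ℝ) ^ (1 - 2 * ε) := by
    rw [← Real.rpow_add hm0, ← Real.rpow_add hm0]
    ring_nf
  rw [show (m : ℝ) ^ (2 - ε) = m * ((m : ℝ) ^ ε * (m : ℝ) ^ (1 - 2 * ε)) by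
    rw [← Real.rpow_add hm0, ← Real.rpow_one_add' hm0.le (by linarith)]
    ring_nf] at hn
  generalize (m : ℝ) ^ ε = X at *
  generalize (m : ℝ) ^ (1 - 2 * ε) = Z at *
  generalize (m : ℝ) ^ (1 - 4 * ε) = W at *
  obtain ⟨g, s, q, hg0, hs0, hq3, hqg, hgs, hgXZ, hsX, t1, t3, t4⟩ :=
    exists_parameters hX20 hZ20 hmXXZ ha hXa hn hm8
  replace hqg : q * g ≤ n := by exact_mod_cast hqg
  have : NeZero q := ⟨by omega⟩
  have hX0 : 0 < X := by linarith
  have hn3 : 3 ≤ n := hq3.trans ((Nat.le_mul_of_pos_right q hg0).trans hqg)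
  have hn1 : (1 : ℝ) ≤ n := by exact_mod_cast (show 1 ≤ n by omega)
  have hn0 : (0 : ℝ) < n := by linarith
  -- Together with `1 ≤ M.cc` and `1 ≤ n`, the assumption bounds both `n` and `M.cc` by `2 ^ (X / 2)
  -- ≤ 2 ^ m`, so neither needs a separate upper bound.
  by_contra! hlt
  rw [lt_div_iff₀ hn0] at hlt
  have hcc1 : (1 : ℝ) ≤ M.cc := by
    exact_mod_cast Nat.one_le_iff_ne_zero.2 (happ.cc_ne_zero hm (by omega) (by omega))
  have hρ1 : 1 ≤ ρ := happ.one_le hm (by omega) (by omega)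
  have hXm : X ≤ m := by
    rw [hmXXZ, mul_assoc]
    exact le_mul_of_one_le_right hX0.le (by nlinarith)
  have hB : (2 : ℝ) ^ ((m : ℝ) ^ (ε ^ 2 / 2)) ≤ 2 ^ (X / 2) :=
    Real.rpow_le_rpow_of_exponent_le one_le_two hexp
  have hB' : (2 : ℝ) ^ (X / 2) ≤ 2 ^ m := by
    rw [← Real.rpow_natCast]
    exact Real.rpow_le_rpow_of_exponent_le one_le_two (by linarith)
  have hnm : (n : ℝ) ≤ 2 ^ m :=
    (le_mul_of_one_le_left hn0.le hcc1).trans (hlt.le.trans (hB.trans hB'))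
  have hccB : (M.cc : ℝ) ≤ 2 ^ (X / 2) :=
    (le_mul_of_one_le_right (by positivity) hn1).trans (hlt.le.trans hB)
  obtain ⟨blk, hblk⟩ := Fin.exists_partition hg0 hqg
  have hmain := half_groups_le_of_approximates hm hn3 hs0 hgs blk hblk hb hnorm hnnt hdom happ hρm
    (by exact_mod_cast hnm) (by exact_mod_cast hccB.trans hB') hm100
  have t2 : (n : ℝ) / 2 ^ m ≤ 1 := (div_le_one (by positivity)).2 hnm
  have t5 := t4 M.cc hccB
  -- Three terms are at most `X` and two at most `1`, and `3 * X + 2 ≤ 4 * X`.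
  have t6 : (g : ℝ) / 2 ≤ 2 * W * (4 * X) :=
    hmain.trans (mul_le_mul (by linarith) (by linarith) (by positivity) (by linarith))
  have t7 : X * Z ≤ 64 * (W * X) := by linarith
  have t8 : 0 < W * X := mul_pos (by linarith) hX0
  have t9 : X * Z = (X * X) * (W * X) := by
    rw [← hW]
    ring
  have t10 : 400 * (W * X) ≤ (X * X) * (W * X) :=
    mul_le_mul_of_nonneg_right (by nlinarith) t8.le
  linarith

end Mechanism

theorem mainTheorem1 (ε : ℝ) (hε : 0 < ε) :
    ∃ c : ℝ, 0 < c ∧ ∀ a : ℝ, 0 < a → ∃ m₀ : ℕ, ∀ m : ℕ, m₀ ≤ m →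
      ∀ n : ℕ, a * (m : ℝ) ^ (2 - ε) ≤ (n : ℝ) →
      ∀ b : ℕ, 2 * m + 1 ≤ b →
      ∀ (M : Mechanism n m) (S : ∀ i, M.Strategy b i),
        M.Normalized → M.NoNegativeTransfers → (∀ i, M.IsDominant b i (S i)) →
        (∃ ρ : ℝ, ρ < (m : ℝ) ^ (1 - 4 * ε) ∧ M.Approximates b S ρ) →
        ((2 : ℝ) ^ ((m : ℝ) ^ (ε ^ 2 / 2)) / (n : ℝ)) ^ c ≤ (M.cc : ℝ) := by
  refine ⟨1, one_pos, fun a ha => ?_⟩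
  rcases lt_or_ge ε (1 / 4) with hε' | hε'
  · obtain ⟨m₀, hm₀⟩ := Filter.eventually_atTop.1 (eventually_large_items a hε hε')
    refine ⟨m₀, fun m hm n hn b hb M S hnorm hnnt hdom ⟨ρ, hρ, happ⟩ => ?_⟩
    obtain ⟨h1, h2, h3, h4, h5, h6⟩ := hm₀ m hm
    rw [Real.rpow_one]
    exact Mechanism.two_rpow_div_le_cc hε hε' ha h1 h2 h3 h4 h5 h6 hn hb hnorm hnnt hdom hρ happ
  -- For `ε ≥ 1 / 4` the required ratio would be below `1`, which no mechanism achieves.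
  · refine ⟨1, fun m hm n hn b hb M S _ _ _ ⟨ρ, hρ, happ⟩ => ?_⟩
    have hm1 : (1 : ℝ) ≤ m := by exact_mod_cast hm
    have hn0 : 0 < n := by
      have : (0 : ℝ) < n := lt_of_lt_of_le (by positivity) hn
      exact_mod_cast this
    have h1 := happ.one_le hm hn0 (by omega)
    have h2 : (m : ℝ) ^ (1 - 4 * ε) ≤ 1 := Real.rpow_le_one_of_one_le_of_nonpos hm1 (by linarith)
    linarith
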